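/- **Setting.** Let $H$ be a complex Hilbert space, $\mathcal M\subseteq B(H)$ a von Neumann algebra with commutant $\mathcal M'$, and $P:\mathcal M\to\mathcal M$ a normal (that is, $\sigma$-weakly continuous), unital, completely positive linear map. Inner products are linear in the second variable. Let $\mathcal M\otimes_P H$ be the Hausdorff completion of the algebraic tensor product $\mathcal M\otimes H$ for the semi-inner product $\langle S\otimes h,T\otimes k\rangle=\langle h,P(S^*T)k\rangle$. For $Y\in B(H)$ let $\Phi_Y$ be the linear map on $\mathcal M\otimes H$ with $\Phi_Y(S\otimes h)=SY^*h$. The *Arveson correspondence* of $P$ is $$\mathcal E_P=\{Y\in B(H):\ \Phi_Y\text{ is continuous and so extends to a bounded operator }\Phi_Y:\mathcal M\otimes_P H\to H\},$$ with left and right actions of $\mathcal M'$ given by operator multiplication and with the $\mathcal M'$-valued inner product $\langle Y,Z\rangle=\Phi_Y\Phi_Z^*$. Its *identity representation* on $H$ is the pair $(T,\sigma)$, $T(Y)=Y$ for $Y\in\mathcal E_P$, $\sigma(S)=S$ for $S\in\mathcal M'$. An *isometric covariant representation* of $\mathcal E_P$ on a Hilbert space $K$ is a pair $(V,\rho)$,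 where $\rho:\mathcal M'\to B(K)$ is a normal $*$-representation and $V:\mathcal E_P\to B(K)$ is linear with $V(SYR)=\rho(S)V(Y)\rho(R)$ and $V(Y)^*V(Z)=\rho(\langle Y,Z\rangle)$ for all $Y,Z\in\mathcal E_P$ and $S,R\in\mathcal M'$. It is, with an isometry $W:H\to K$, a *minimal isometric dilation* of $(T,\sigma)$ if * $WW^*$ commutes with $\rho(\mathcal M')$ and $\rho(S)W=W\sigma(S)$ for all $S\in\mathcal M'$; * $V(Y)^*WH\subseteq WH$ and $W^*V(Y)W=T(Y)$ for all $Y\in\mathcal E_P$; * the smallest closed subspace of $K$ that contains $WH$ and is invariant under all $V(Y)$, $V(Y)^*$ and $\rho(S)$ is $K$. Given $(V,\rho)$, put $\mathcal R=\rho(\mathcal M')'$. Let $\mathcal E_P\otimes_\rho K$ be the Hausdorff completion of $\mathcal E_P\otimes K$ for $\langle Y\otimes k,Z\otimes l\rangle=\langle k,\rho(\langle Y,Z\rangle)l\rangle$, let $\tilde V:\mathcal E_P\otimes_\rho K\to K$ be the operator with $\tilde V(Y\otimes k)=V(Y)k$, and let the *induced map* $\Theta_V:\mathcal R\to\mathcal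 R$ be $\Theta_V(S)=\tilde V(I\otimes S)\tilde V^*$. **Theorem.** The identity representation $(T,\sigma)$ of $\mathcal E_P$ has a minimal isometric dilation. If $(V,\rho)$ on $K$, with embedding $W:H\to K$, is any minimal isometric dilation of $(T,\sigma)$, and $\mathcal R=\rho(\mathcal M')'$, then 1. $W^*\mathcal RW=\mathcal M$, so that $\mathcal M$ is a corner of $\mathcal R$: the projection $e=WW^*$ belongs to $\mathcal R$ and $W\mathcal MW^*=e\mathcal Re$. Moreover $\mathcal R'=\rho(\mathcal M')$, so that $\mathcal R'$ is a normal homomorphic image of $\mathcal M'$. 2. $\Theta_V$ is a unital, normal $*$-endomorphism of $\mathcal R$. 3. For every integer $n\ge 0$, every $A\in\mathcal M$ and every $S\in\mathcal R$, $$P^n(A)=W^*\Theta_V^n(WAW^*)W\qquad\text{and}\qquad P^n(W^*SW)=W^*\Theta_V^n(S)W ,$$ so that $\Theta_V$ is a power dilation of $P$. -/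

import Mathlib

universe u v w

namespace ArvesonDilation

open scoped CStarAlgebra TensorProduct ComplexOrder

noncomputable section

/-! ### Von Neumann algebras as C⋆-algebras, complete positivity -/

section VonNeumann

variable {H : Type u} [NormedAddCommGroup H] [InnerProductSpace ℂ H] [CompleteSpace H]

instance instSMulMemClass : SMulMemClass (VonNeumannAlgebra H) ℂ (H →L[ℂ] H) where
  smul_mem {M} c _ hx := M.toStarSubalgebra.smul_mem hx c

instance instIsClosed (M : VonNeumannAlgebra H) : IsClosed (M : Set (H →L[ℂ] H)) := by
  rw [← M.centralizer_centralizer]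
  exact Set.isClosed_centralizer _

theorem mem_of_commute (M : VonNeumannAlgebra H) {X : H →L[ℂ] H}
    (h : ∀ A ∈ M.commutant, A * X = X * A) : X ∈ M := by
  rw [← M.commutant_commutant, VonNeumannAlgebra.mem_commutant_iff]
  exact h

theorem mul_comm_of_mem {M : VonNeumannAlgebra H} {A X : H →L[ℂ] H} (hA : A ∈ M)
    (hX : X ∈ M.commutant) : A * X = X * A :=
  VonNeumannAlgebra.mem_commutant_iff.1 hX A hA

theorem exists_star_mul_self (M : VonNeumannAlgebra H) {X : H →L[ℂ] H} (hX : X ∈ M)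
    (h0 : 0 ≤ X) : ∃ Y ∈ M, X = star Y * Y := by
  refine ⟨CFC.sqrt X, mem_of_commute M fun A hA => ?_, ?_⟩
  · rw [CFC.sqrt_eq_cfc]
    exact (Commute.cfc_nnreal (VonNeumannAlgebra.mem_commutant_iff.1 hA X hX) _).symm.eq
  · rw [(CFC.sqrt_nonneg X).isSelfAdjoint.star_eq, CFC.sqrt_mul_sqrt_self X h0]

/-- For `X` in a von Neumann algebra, `‖X‖² - X⋆X` has the form `Y⋆Y` with `Y` in the algebra. -/
theorem exists_defect (M : VonNeumannAlgebra H) {X : H →L[ℂ] H} (hX : X ∈ M) :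
    ∃ Y ∈ M, star X * X + star Y * Y = ((‖X‖ ^ 2 : ℝ) : ℂ) • (1 : H →L[ℂ] H) := by
  have hle : star X * X ≤ ((‖X‖ ^ 2 : ℝ) : ℂ) • (1 : H →L[ℂ] H) := by
    have := CStarAlgebra.star_mul_le_algebraMap_norm_sq (a := X)
    rwa [Algebra.algebraMap_eq_smul_one, ← Complex.coe_smul] at this
  obtain ⟨Y, hY, e⟩ := exists_star_mul_self M
    (X := ((‖X‖ ^ 2 : ℝ) : ℂ) • (1 : H →L[ℂ] H) - star X * X)
    (sub_mem (SMulMemClass.smul_mem _ (one_mem M)) (mul_mem (star_mem hX) hX))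
    (sub_nonneg.2 hle)
  exact ⟨Y, hY, by rw [← e]; abel⟩

/-- The operators of a von Neumann algebra, with their usual order as operators, form a
star-ordered ring. -/
instance instStarOrderedRing (M : VonNeumannAlgebra H) : StarOrderedRing M :=
  StarOrderedRing.of_nonneg_iff'
    (fun {x y} h z => by
      change (z : H →L[ℂ] H) + x ≤ z + y
      have h' : (x : H →L[ℂ] H) ≤ y := h
      gcongr)
    (fun X => by
      constructor
      · intro h
        obtain ⟨Y, hY, e⟩ := exists_star_mul_self M X.2 h
        exact ⟨⟨Y, hY⟩, Subtype.ext e⟩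
      · rintro ⟨Y, rfl⟩
        exact star_mul_self_nonneg (Y : H →L[ℂ] H))

theorem cp_nonneg {M : VonNeumannAlgebra H} (P : M →CP M) {n : ℕ} (S : Fin n → M)
    (h : Fin n → H) :
    0 ≤ ∑ i, ∑ j, inner ℂ (h i) ((P (star (S i) * S j) : H →L[ℂ] H) (h j)) := by
  classical
  have key : ∀ X : CStarMatrix (Fin n) (Fin n) M, 0 ≤ X →
      0 ≤ ∑ i, ∑ j, inner ℂ (h i) ((X i j : H →L[ℂ] H) (h j)) := by
    intro X hX
    rw [StarOrderedRing.nonneg_iff] at hX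
    induction hX using AddSubmonoid.closure_induction with
    | zero => simp
    | add X Y _ _ hx hy =>
      simpa [Finset.sum_add_distrib, inner_add_right] using add_nonneg hx hy
    | mem X hX =>
      obtain ⟨Y, rfl⟩ := hX
      have : ∑ i, ∑ j, inner ℂ (h i) (((star Y * Y) i j : H →L[ℂ] H) (h j))
          = ∑ k, inner ℂ (∑ i, (Y k i : H →L[ℂ] H) (h i))
              (∑ j, (Y k j : H →L[ℂ] H) (h j)) := by
        have e : ∀ i j, inner ℂ (h i) (((star Y * Y) i j : H →L[ℂ] H) (h j))
            = ∑ k, inner ℂ ((Y k i : H →L[ℂ] H) (h i)) ((Y k j : H →L[ℂ] H) (h j)) := by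
          intro i j
          have e1 : ((star Y * Y) i j : M) = ∑ k, star (Y k i) * Y k j := by
            simp [CStarMatrix.mul_apply, CStarMatrix.star_apply]
          have e2 : ((∑ k, star (Y k i) * Y k j : M) : H →L[ℂ] H)
              = ∑ k, star (Y k i : H →L[ℂ] H) * (Y k j : H →L[ℂ] H) := by
            simp
          rw [e1, e2, sum_apply, inner_sum]
          refine Finset.sum_congr rfl fun k _ => ?_
          rw [mul_apply_eq_comp, ContinuousLinearMap.star_eq_adjoint,
            ContinuousLinearMap.adjoint_inner_right]
        simp only [e, sum_inner, inner_sum]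
        calc _ = ∑ i, ∑ k, ∑ j, inner ℂ ((Y k i : H →L[ℂ] H) (h i))
                ((Y k j : H →L[ℂ] H) (h j)) :=
              Finset.sum_congr rfl fun i _ => Finset.sum_comm
          _ = _ := by
              rw [Finset.sum_comm]
              first
                | rfl
                | exact Finset.sum_congr rfl fun k _ => Finset.sum_comm
      rw [this]
      refine Finset.sum_nonneg fun k _ => ?_
      rw [inner_self_eq_norm_sq_to_K]
      simp
  let B : CStarMatrix (Fin n) (Fin n) M := CStarMatrix.ofMatrix fun i j => star (S i) * S j
  have hB : 0 ≤ B := by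
    rcases Nat.eq_zero_or_pos n with rfl | hn
    · have : B = 0 := by ext i; exact i.elim0
      rw [this]
    · let Y : CStarMatrix (Fin n) (Fin n) M :=
        CStarMatrix.ofMatrix fun i j => if i = ⟨0, hn⟩ then S j else 0
      have hY : ∀ k j, Y k j = if k = ⟨0, hn⟩ then S j else 0 := fun _ _ => rfl
      have : B = star Y * Y := by
        ext i j : 2
        rw [CStarMatrix.mul_apply, Finset.sum_eq_single ⟨0, hn⟩]
        · rw [CStarMatrix.star_apply, hY, hY, if_pos rfl, if_pos rfl]; rfl
        · intro k _ hk
          rw [hY k j, if_neg hk, mul_zero]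
        · simp
      rw [this]
      exact star_mul_self_nonneg Y
  exact key _ (P.map_cstarMatrix_nonneg' n B hB)

end VonNeumann

/-! ### The σ-weak topology and normal maps -/

/-- The σ-weak topology on `B(H)`: the weakest topology for which all the functionals
`T ↦ ∑ₙ ⟨ηₙ, T ξₙ⟩` with `∑ ‖ξₙ‖² < ∞` and `∑ ‖ηₙ‖² < ∞` are continuous. -/
@[reducible]
def sigmaWeak (H : Type u) [NormedAddCommGroup H] [InnerProductSpace ℂ H] :
    TopologicalSpace (H →L[ℂ] H) :=
  ⨅ p : {p : (ℕ → H) × (ℕ → H) //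
      Summable (fun n => ‖p.1 n‖ ^ 2) ∧ Summable (fun n => ‖p.2 n‖ ^ 2)},
    TopologicalSpace.induced (fun T : H →L[ℂ] H => ∑' n, inner ℂ (p.1.2 n) (T (p.1.1 n)))
      inferInstance

/-- A map from a von Neumann algebra `M ⊆ B(H)` to `B(K)` is *normal* if it is continuous for the
σ-weak topologies. -/
def IsNormal {H : Type u} [NormedAddCommGroup H] [InnerProductSpace ℂ H] [CompleteSpace H]
    {K : Type v} [NormedAddCommGroup K] [InnerProductSpace ℂ K]
    (M : VonNeumannAlgebra H) (f : M → (K →L[ℂ] K)) : Prop :=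
  @Continuous M (K →L[ℂ] K) (TopologicalSpace.induced Subtype.val (sigmaWeak H)) (sigmaWeak K) f

/-! ### Interior tensor products -/

section Kernel

/-- A positive semidefinite sesquilinear `B(H)`-valued form on a vector space `A`. -/
structure PosForm (A : Type v) [AddCommGroup A] [Module ℂ A]
    (H : Type u) [NormedAddCommGroup H] [InnerProductSpace ℂ H] [CompleteSpace H] where
  form : A →ₗ⋆[ℂ] A →ₗ[ℂ] (H →L[ℂ] H)
  star_form : ∀ a b, star (form a b) = form b a
  nonneg : ∀ (n : ℕ) (a : Fin n → A) (h : Fin n → H),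
    0 ≤ (∑ i, ∑ j, inner ℂ (h i) (form (a i) (a j) (h j))).re

variable {A : Type v} [AddCommGroup A] [Module ℂ A]
variable {H : Type u} [NormedAddCommGroup H] [InnerProductSpace ℂ H] [CompleteSpace H]

namespace PosForm

/-- The algebraic tensor product `A ⊗ H`, which carries the semi-inner product
`⟨a ⊗ h, b ⊗ k⟩ = ⟨h, κ(a, b) k⟩`. -/
@[nolint unusedArguments]
def Pre (_ : PosForm A H) : Type max u v := A ⊗[ℂ] H

variable (κ : PosForm A H)

instance : AddCommGroup κ.Pre := inferInstanceAs (AddCommGroup (A ⊗[ℂ] H))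
instance : Module ℂ κ.Pre := inferInstanceAs (Module ℂ (A ⊗[ℂ] H))

/-- The elementary tensors `a ⊗ h`, before completion. -/
def pure : A →ₗ[ℂ] H →ₗ[ℂ] κ.Pre := TensorProduct.mk ℂ A H

/-- Linear maps out of the algebraic tensor product. -/
def lift {X : Type w} [AddCommGroup X] [Module ℂ X] (f : A →ₗ[ℂ] H →ₗ[ℂ] X) : κ.Pre →ₗ[ℂ] X :=
  TensorProduct.lift f

@[simp] theorem lift_pure {X : Type w} [AddCommGroup X] [Module ℂ X] (f : A →ₗ[ℂ] H →ₗ[ℂ] X)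
    (a : A) (h : H) : κ.lift f (κ.pure a h) = f a h := rfl

/-- `b ⊗ k ↦ ⟨h, κ(a, b) k⟩`. -/
def gramRight (a : A) (h : H) : κ.Pre →ₗ[ℂ] ℂ :=
  TensorProduct.lift (LinearMap.mk₂ ℂ (fun (b : A) (k : H) => inner ℂ h (κ.form a b k))
    (by intros; simp) (by intros; simp)
    (by intros; simp) (by intros; simp))

theorem gramRight_pure (a b : A) (h k : H) :
    κ.gramRight a h (κ.pure b k) = inner ℂ h (κ.form a b k) := rfl

theorem pre_hom_ext {X : Type w} [AddCommMonoid X] [Module ℂ X] {f g : κ.Pre →ₗ[ℂ] X}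
    (h : ∀ a x, f (κ.pure a x) = g (κ.pure a x)) : f = g :=
  TensorProduct.ext' h

/-- The semi-inner product on the algebraic tensor product. -/
def gram : κ.Pre →ₗ⋆[ℂ] (κ.Pre →ₗ[ℂ] ℂ) :=
  TensorProduct.lift (LinearMap.mk₂'ₛₗ (starRingEnd ℂ) (starRingEnd ℂ) κ.gramRight
    (fun a a' h => κ.pre_hom_ext fun b k => by simp [gramRight_pure])
    (fun c a h => κ.pre_hom_ext fun b k => by simp [gramRight_pure])
    (fun a h h' => κ.pre_hom_ext fun b k => by simp [gramRight_pure])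
    (fun c a h => κ.pre_hom_ext fun b k => by simp [gramRight_pure, mul_comm]))

theorem gram_pure (a b : A) (h k : H) :
    κ.gram (κ.pure a h) (κ.pure b k) = inner ℂ h (κ.form a b k) := rfl

@[elab_as_elim]
theorem pre_induction {p : κ.Pre → Prop} (x : κ.Pre) (h0 : p 0) (h1 : ∀ a h, p (κ.pure a h))
    (h2 : ∀ x y, p x → p y → p (x + y)) : p x :=
  TensorProduct.induction_on x h0 h1 h2

theorem exists_sum (x : κ.Pre) : ∃ (n : ℕ) (a : Fin n → A) (h : Fin n → H),
    x = ∑ i, κ.pure (a i) (h i) := by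
  induction x using κ.pre_induction with
  | h0 => exact ⟨0, Fin.elim0, Fin.elim0, by simp⟩
  | h1 a h => exact ⟨1, fun _ => a, fun _ => h, by simp⟩
  | h2 x y hx hy =>
    obtain ⟨n, a, h, rfl⟩ := hx
    obtain ⟨m, b, k, rfl⟩ := hy
    refine ⟨n + m, Fin.append a b, Fin.append h k, ?_⟩
    rw [Fin.sum_univ_add]
    simp

theorem gram_conj (x y : κ.Pre) : starRingEnd ℂ (κ.gram y x) = κ.gram x y := by
  induction x using κ.pre_induction with
  | h0 => simp
  | h2 x x' hx hx' => simp [hx, hx']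
  | h1 a h =>
    induction y using κ.pre_induction with
    | h0 => simp
    | h2 y y' hy hy' => simp [hy, hy']
    | h1 b k =>
      rw [gram_pure, gram_pure, inner_conj_symm, ← κ.star_form b a,
        ContinuousLinearMap.star_eq_adjoint, ContinuousLinearMap.adjoint_inner_right]

theorem gram_sum {n : ℕ} (a : Fin n → A) (h : Fin n → H) :
    κ.gram (∑ i, κ.pure (a i) (h i)) (∑ i, κ.pure (a i) (h i))
      = ∑ i, ∑ j, inner ℂ (h i) (κ.form (a i) (a j) (h j)) := by
  simp only [map_sum, LinearMap.sum_apply, gram_pure]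
  first
    | rfl
    | exact Finset.sum_comm

/-- The semi-inner product `⟨a ⊗ h, b ⊗ k⟩ = ⟨h, κ(a, b) k⟩`. -/
@[reducible]
def preCore : PreInnerProductSpace.Core ℂ κ.Pre where
  inner x y := κ.gram x y
  conj_inner_symm x y := κ.gram_conj x y
  re_inner_nonneg x := by
    obtain ⟨n, a, h, rfl⟩ := κ.exists_sum x
    rw [gram_sum]
    exact κ.nonneg n a h
  add_left x y z := by simp
  smul_left x y c := by simp

instance : SeminormedAddCommGroup κ.Pre :=
  InnerProductSpace.Core.toSeminormedAddCommGroup (c := κ.preCore)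
instance : InnerProductSpace ℂ κ.Pre := InnerProductSpace.ofCore κ.preCore

theorem inner_def (x y : κ.Pre) : inner ℂ x y = κ.gram x y := rfl

theorem inner_pure (a b : A) (h k : H) :
    inner ℂ (κ.pure a h) (κ.pure b k) = inner ℂ h (κ.form a b k) := rfl

/-- The Hausdorff completion `A ⊗_κ H` of the algebraic tensor product. -/
abbrev Space : Type max u v := UniformSpace.Completion κ.Pre

/-- The vector `a ⊗ h` of `A ⊗_κ H`. -/
def tmul (a : A) (h : H) : κ.Space := (κ.pure a h : κ.Pre)

theorem inner_tmul (a b : A) (h k : H) :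
    inner ℂ (κ.tmul a h) (κ.tmul b k) = inner ℂ h (κ.form a b k) := by
  rw [tmul, tmul, UniformSpace.Completion.inner_coe, inner_pure]

/-- Bounded operators on `A ⊗_κ H` that agree on elementary tensors are equal. -/
theorem hom_ext {X : Type w} [NormedAddCommGroup X] [NormedSpace ℂ X] {f g : κ.Space →L[ℂ] X}
    (h : ∀ a x, f (κ.tmul a x) = g (κ.tmul a x)) : f = g := by
  ext z
  induction z using UniformSpace.Completion.induction_on with
  | hp => exact isClosed_eq f.continuous g.continuous
  | ih x =>
    induction x using κ.pre_induction with
    | h0 => rw [UniformSpace.Completion.coe_zero, map_zero, map_zero]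
    | h1 a h' => exact h a h'
    | h2 x y hx hy => simp [UniformSpace.Completion.coe_add, hx, hy]

/-- The operator on `A ⊗_κ H` induced by a bounded operator on the algebraic tensor product. -/
def mapOfBound (f : κ.Pre →ₗ[ℂ] κ.Pre) (C : ℝ) (hf : ∀ x, ‖f x‖ ≤ C * ‖x‖) :
    κ.Space →L[ℂ] κ.Space := (f.mkContinuous C hf).completion

theorem mapOfBound_tmul (f : κ.Pre →ₗ[ℂ] κ.Pre) (C : ℝ) (hf : ∀ x, ‖f x‖ ≤ C * ‖x‖)
    (a : A) (h : H) : κ.mapOfBound f C hf (κ.tmul a h) = (f (κ.pure a h) : κ.Pre) := by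
  simp [mapOfBound, tmul]

theorem norm_sq_eq (x : κ.Pre) : ‖x‖ ^ 2 = (κ.gram x x).re := by
  rw [← inner_def, ← inner_self_eq_norm_sq (𝕜 := ℂ)]; rfl

/-- `a ⊗ h ↦ a ⊗ S h` on the algebraic tensor product. -/
def preRight (S : H →L[ℂ] H) : κ.Pre →ₗ[ℂ] κ.Pre :=
  κ.lift (κ.pure.compl₂ (S : H →ₗ[ℂ] H))

theorem preRight_pure (S : H →L[ℂ] H) (a : A) (h : H) :
    κ.preRight S (κ.pure a h) = κ.pure a (S h) := rfl

/-- `I ⊗ S` is bounded with norm at most `‖S‖` if `S` belongs to a von Neumann algebra that commutes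
with the values of the form. -/
theorem norm_preRight_le (N : VonNeumannAlgebra H) (hN : ∀ a b, κ.form a b ∈ N.commutant)
    {S : H →L[ℂ] H} (hS : S ∈ N) (x : κ.Pre) : ‖κ.preRight S x‖ ≤ ‖S‖ * ‖x‖ := by
  obtain ⟨Y, hY, hYe⟩ := exists_defect N hS
  have main : ∀ x y : κ.Pre, κ.gram (κ.preRight S x) (κ.preRight S y)
      + κ.gram (κ.preRight Y x) (κ.preRight Y y) = ((‖S‖ ^ 2 : ℝ) : ℂ) * κ.gram x y := by
    intro x y
    induction x using κ.pre_induction with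
    | h0 => simp
    | h2 x x' hx hx' =>
      simp only [map_add, LinearMap.add_apply, mul_add, ← hx, ← hx']; abel
    | h1 a h =>
      induction y using κ.pre_induction with
      | h0 => simp
      | h2 y y' hy hy' => simp only [map_add, mul_add, ← hy, ← hy']; abel
      | h1 b k =>
        simp only [preRight_pure, gram_pure]
        have hc : ∀ Z ∈ N, inner ℂ (Z h) (κ.form a b (Z k))
            = inner ℂ h (κ.form a b ((star Z * Z) k)) := by
          intro Z hZ
          have h1 := mul_comm_of_mem (star_mem hZ) (hN a b)
          rw [← ContinuousLinearMap.adjoint_inner_right, ← ContinuousLinearMap.star_eq_adjoint,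
            mul_apply_eq_comp]
          exact congrArg (inner ℂ h) (DFunLike.congr_fun h1 (Z k))
        rw [hc S hS, hc Y hY, ← inner_add_right, ← map_add, ← add_apply, hYe]
        simp [inner_smul_right]
  have h2 := congrArg Complex.re (main x x)
  rw [Complex.add_re, Complex.re_ofReal_mul, ← norm_sq_eq, ← norm_sq_eq, ← norm_sq_eq] at h2
  refine le_of_sq_le_sq ?_ (by positivity)
  nlinarith [sq_nonneg ‖κ.preRight Y x‖]

/-- The operator `I ⊗ S : a ⊗ h ↦ a ⊗ S h` on `A ⊗_κ H`, for `S` in a von Neumann algebra that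
commutes with the values of the form. -/
def right (N : VonNeumannAlgebra H) (hN : ∀ a b, κ.form a b ∈ N.commutant) (S : N) :
    κ.Space →L[ℂ] κ.Space :=
  κ.mapOfBound (κ.preRight S) ‖(S : H →L[ℂ] H)‖ (κ.norm_preRight_le N hN S.2)

theorem right_tmul (N : VonNeumannAlgebra H) (hN : ∀ a b, κ.form a b ∈ N.commutant) (S : N)
    (a : A) (h : H) : κ.right N hN S (κ.tmul a h) = κ.tmul a ((S : H →L[ℂ] H) h) := by
  rw [right, mapOfBound_tmul, preRight_pure]; rfl

end PosForm

end Kernel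

/-! ### The Stinespring space and the Arveson correspondence -/

section Arveson

variable {H : Type u} [NormedAddCommGroup H] [InnerProductSpace ℂ H] [CompleteSpace H]
variable {M : VonNeumannAlgebra H}

/-- The form `(S, T) ↦ P(S⋆T)` on `M` associated with a completely positive map `P`. -/
def cpForm (P : M →CP M) : PosForm M H where
  form := LinearMap.mk₂'ₛₗ (starRingEnd ℂ) (RingHom.id ℂ)
    (fun S T => (P (star S * T) : H →L[ℂ] H))
    (by intros; simp [add_mul]) (by intros; simp)
    (by intros; simp [mul_add]) (by intros; simp)
  star_form S T := by
    change star (P (star S * T) : H →L[ℂ] H) = (P (star T * S) : H →L[ℂ] H)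
    rw [← star_star S, ← star_mul, map_star, star_star]
    simp
  nonneg n S h := (Complex.nonneg_iff.1 (cp_nonneg P S h)).1

theorem cpForm_apply (P : M →CP M) (S T : M) :
    (cpForm P).form S T = (P (star S * T) : H →L[ℂ] H) := rfl

/-- The space `M ⊗_P H` of the minimal Stinespring dilation of `P`: the Hausdorff completion of
`M ⊗ H` for `⟨S ⊗ h, T ⊗ k⟩ = ⟨h, P(S⋆T) k⟩`. -/
abbrev Stinespring (P : M →CP M) : Type u := (cpForm P).Space

/-- `S ⊗ h ↦ T S ⊗ h` on the algebraic tensor product. -/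
def preLeft (P : M →CP M) (T : M) : (cpForm P).Pre →ₗ[ℂ] (cpForm P).Pre :=
  (cpForm P).lift ((cpForm P).pure ∘ₗ LinearMap.mulLeft ℂ T)

theorem preLeft_pure (P : M →CP M) (T S : M) (h : H) :
    preLeft P T ((cpForm P).pure S h) = (cpForm P).pure (T * S) h := rfl

theorem norm_preLeft_le (P : M →CP M) (T : M) (x : (cpForm P).Pre) :
    ‖preLeft P T x‖ ≤ ‖(T : H →L[ℂ] H)‖ * ‖x‖ := by
  obtain ⟨Y, hY, hYe⟩ := exists_defect M T.2
  have hYe' : star T * T + star (⟨Y, hY⟩ : M) * ⟨Y, hY⟩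
      = ((‖(T : H →L[ℂ] H)‖ ^ 2 : ℝ) : ℂ) • (1 : M) := Subtype.ext hYe
  have main : ∀ x y : (cpForm P).Pre, (cpForm P).gram (preLeft P T x) (preLeft P T y)
      + (cpForm P).gram (preLeft P ⟨Y, hY⟩ x) (preLeft P ⟨Y, hY⟩ y)
      = ((‖(T : H →L[ℂ] H)‖ ^ 2 : ℝ) : ℂ) * (cpForm P).gram x y := by
    intro x y
    induction x using (cpForm P).pre_induction with
    | h0 => simp
    | h2 x x' hx hx' =>
      simp only [map_add, LinearMap.add_apply, mul_add, ← hx, ← hx']; abel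
    | h1 a h =>
      induction y using (cpForm P).pre_induction with
      | h0 => simp
      | h2 y y' hy hy' => simp only [map_add, mul_add, ← hy, ← hy']; abel
      | h1 b k =>
        rw [preLeft_pure, preLeft_pure, preLeft_pure, preLeft_pure, PosForm.gram_pure,
          PosForm.gram_pure, PosForm.gram_pure, cpForm_apply, cpForm_apply, cpForm_apply,
          ← inner_add_right, ← add_apply]
        have e : P (star (T * a) * (T * b)) + P (star (⟨Y, hY⟩ * a) * (⟨Y, hY⟩ * b))
            = ((‖(T : H →L[ℂ] H)‖ ^ 2 : ℝ) : ℂ) • P (star a * b) := by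
          rw [← map_add, ← map_smul]
          congr 1
          calc _ = star a * (star T * T + star (⟨Y, hY⟩ : M) * ⟨Y, hY⟩) * b := by
                rw [star_mul, star_mul, mul_add, add_mul]; simp only [mul_assoc]
            _ = _ := by rw [hYe']; simp
        have e' := congrArg (fun X : M => (X : H →L[ℂ] H)) e
        have e2 : (P (star (T * a) * (T * b)) : H →L[ℂ] H)
            + (P (star (⟨Y, hY⟩ * a) * (⟨Y, hY⟩ * b)) : H →L[ℂ] H)
            = ((‖(T : H →L[ℂ] H)‖ ^ 2 : ℝ) : ℂ) • (P (star a * b) : H →L[ℂ] H) := e'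
        rw [e2, smul_apply, inner_smul_right]
  have h2 := congrArg Complex.re (main x x)
  rw [Complex.add_re, Complex.re_ofReal_mul, ← (cpForm P).norm_sq_eq, ← (cpForm P).norm_sq_eq,
    ← (cpForm P).norm_sq_eq] at h2
  refine le_of_sq_le_sq ?_ (by positivity)
  nlinarith [sq_nonneg ‖preLeft P ⟨Y, hY⟩ x‖]

/-- The Stinespring representation `π_P(T) : S ⊗ h ↦ T S ⊗ h`. -/
def stinespringRep (P : M →CP M) (T : M) : Stinespring P →L[ℂ] Stinespring P :=
  (cpForm P).mapOfBound (preLeft P T) ‖(T : H →L[ℂ] H)‖ (norm_preLeft_le P T)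

theorem stinespringRep_tmul (P : M →CP M) (T S : M) (h : H) :
    stinespringRep P T ((cpForm P).tmul S h) = (cpForm P).tmul (T * S) h := by
  rw [stinespringRep, PosForm.mapOfBound_tmul, preLeft_pure]; rfl

/-- `Φ_Y : S ⊗ h ↦ S Y⋆ h` on the algebraic tensor product `M ⊗ H`. -/
def prePhi (P : M →CP M) (Y : H →L[ℂ] H) : (cpForm P).Pre →ₗ[ℂ] H :=
  (cpForm P).lift (LinearMap.mk₂ ℂ (fun (S : M) (h : H) => (S : H →L[ℂ] H) (star Y h))
    (by intros; simp) (by intros; simp) (by intros; simp) (by intros; simp))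

theorem prePhi_pure (P : M →CP M) (Y : H →L[ℂ] H) (S : M) (h : H) :
    prePhi P Y ((cpForm P).pure S h) = (S : H →L[ℂ] H) (star Y h) := rfl

/-- The Arveson correspondence `E_P`: all `Y ∈ B(H)` for which `Φ_Y` is continuous for the
semi-norm of `M ⊗_P H`. -/
def arveson (P : M →CP M) : Submodule ℂ (H →L[ℂ] H) where
  carrier := {Y | Continuous (prePhi P Y)}
  zero_mem' := by
    have : prePhi P 0 = 0 := PosForm.pre_hom_ext _ fun S h => by simp [prePhi_pure]
    change Continuous (prePhi P 0)
    rw [this]; exact continuous_const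
  add_mem' {Y Z} hY hZ := by
    have : prePhi P (Y + Z) = prePhi P Y + prePhi P Z :=
      PosForm.pre_hom_ext _ fun S h => by simp [prePhi_pure]
    change Continuous (prePhi P (Y + Z))
    rw [this]; exact hY.add hZ
  smul_mem' c Y hY := by
    have : prePhi P (c • Y) = (starRingEnd ℂ c) • prePhi P Y :=
      PosForm.pre_hom_ext _ fun S h => by simp [prePhi_pure]
    change Continuous (prePhi P (c • Y))
    rw [this]; exact hY.const_smul (starRingEnd ℂ c)

/-- The continuous extension `Φ_Y : M ⊗_P H → H` for `Y ∈ E_P`. -/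
def phi (P : M →CP M) (Y : arveson P) : Stinespring P →L[ℂ] H :=
  ContinuousLinearMap.fromCompletion (⟨prePhi P Y, Y.2⟩ : (cpForm P).Pre →L[ℂ] H)

theorem phi_tmul (P : M →CP M) (Y : arveson P) (S : M) (h : H) :
    phi P Y ((cpForm P).tmul S h) = (S : H →L[ℂ] H) (star (Y : H →L[ℂ] H) h) := by
  rw [phi, PosForm.tmul, ContinuousLinearMap.fromCompletion_apply_coe]; rfl

theorem phi_stinespringRep (P : M →CP M) (Y : arveson P) (T : M) :
    phi P Y ∘L stinespringRep P T = (T : H →L[ℂ] H) ∘L phi P Y :=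
  PosForm.hom_ext _ fun S h => by
    simp only [ContinuousLinearMap.comp_apply, stinespringRep_tmul, phi_tmul]; rfl

theorem adjoint_stinespringRep (P : M →CP M) (T : M) :
    ContinuousLinearMap.adjoint (stinespringRep P T) = stinespringRep P (star T) := by
  refine PosForm.hom_ext _ fun S h => ?_
  have : ∀ z, inner ℂ z (ContinuousLinearMap.adjoint (stinespringRep P T) ((cpForm P).tmul S h))
      = inner ℂ z (stinespringRep P (star T) ((cpForm P).tmul S h)) := by
    intro z
    rw [ContinuousLinearMap.adjoint_inner_right]
    rw [← inner_conj_symm, ← inner_conj_symm z]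
    congr 1
    have e : (innerSL ℂ ((cpForm P).tmul S h)) ∘L stinespringRep P T
        = innerSL ℂ (stinespringRep P (star T) ((cpForm P).tmul S h)) :=
      PosForm.hom_ext _ fun R k => by
        simp only [ContinuousLinearMap.comp_apply, innerSL_apply_apply, stinespringRep_tmul,
          PosForm.inner_tmul, cpForm_apply]
        rw [star_mul, star_star, mul_assoc]
    exact DFunLike.congr_fun e z
  exact ext_inner_left ℂ this

/-- The `M'`-valued inner product `⟨Y, Z⟩ = Φ_Y Φ_Z⋆` on `E_P`. -/
def arvesonInner (P : M →CP M) (Y Z : arveson P) : M.commutant :=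
  ⟨phi P Y ∘L ContinuousLinearMap.adjoint (phi P Z), by
    rw [VonNeumannAlgebra.mem_commutant_iff]
    intro T hT
    have h1 := phi_stinespringRep P Y ⟨T, hT⟩
    have h2 := congrArg ContinuousLinearMap.adjoint (phi_stinespringRep P Z (star ⟨T, hT⟩))
    rw [ContinuousLinearMap.adjoint_comp, ContinuousLinearMap.adjoint_comp,
      adjoint_stinespringRep, star_star] at h2
    have h3 : ContinuousLinearMap.adjoint ((star (⟨T, hT⟩ : M) : M) : H →L[ℂ] H) = T := by
      change star (star T) = T
      exact star_star T
    rw [h3] at h2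
    change T ∘L (phi P Y ∘L _) = (phi P Y ∘L _) ∘L T
    rw [ContinuousLinearMap.comp_assoc, ← h2, ← ContinuousLinearMap.comp_assoc,
      ← ContinuousLinearMap.comp_assoc, h1]⟩

/-- `E_P` is stable under left multiplication by `M'`. -/
theorem lmul_mem (P : M →CP M) {S Y : H →L[ℂ] H} (hS : S ∈ M.commutant) (hY : Y ∈ arveson P) :
    S * Y ∈ arveson P := by
  have e : prePhi P (S * Y) = prePhi P Y ∘ₗ (cpForm P).preRight (star S) :=
    PosForm.pre_hom_ext _ fun T h => by
      rw [LinearMap.comp_apply, PosForm.preRight_pure, prePhi_pure, prePhi_pure, star_mul]; rfl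
  change Continuous (prePhi P (S * Y))
  rw [e, LinearMap.coe_comp]
  have hc : Continuous ((cpForm P).preRight (star S)) :=
    (((cpForm P).preRight (star S)).mkContinuous _ ((cpForm P).norm_preRight_le M.commutant
      (fun a b => by rw [M.commutant_commutant]; exact (P (star a * b)).2)
      (star_mem hS))).continuous
  exact Continuous.comp (show Continuous (prePhi P Y) from hY) hc

/-- `E_P` is stable under right multiplication by `M'`. -/
theorem rmul_mem (P : M →CP M) {S Y : H →L[ℂ] H} (hY : Y ∈ arveson P) (hS : S ∈ M.commutant) :
    Y * S ∈ arveson P := by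
  have e : prePhi P (Y * S) = (star S : H →L[ℂ] H).toLinearMap ∘ₗ prePhi P Y :=
    PosForm.pre_hom_ext _ fun T h => by
      rw [LinearMap.comp_apply, prePhi_pure, prePhi_pure, star_mul]
      have := mul_comm_of_mem T.2 (star_mem hS)
      exact DFunLike.congr_fun this (star Y h)
  change Continuous (prePhi P (Y * S))
  rw [e]
  exact (star S : H →L[ℂ] H).continuous.comp (show Continuous (prePhi P Y) from hY)

/-- The left action of `M'` on `E_P`. -/
def lact (P : M →CP M) (S : M.commutant) (Y : arveson P) : arveson P :=
  ⟨(S : H →L[ℂ] H) * Y, lmul_mem P S.2 Y.2⟩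

/-- The right action of `M'` on `E_P`. -/
def ract (P : M →CP M) (Y : arveson P) (S : M.commutant) : arveson P :=
  ⟨(Y : H →L[ℂ] H) * S, rmul_mem P Y.2 S.2⟩

end Arveson

/-! ### Covariant representations, isometric dilations, induced endomorphisms -/

section Rep

variable {H : Type u} [NormedAddCommGroup H] [InnerProductSpace ℂ H] [CompleteSpace H]
variable {M : VonNeumannAlgebra H}

/-- An isometric covariant representation `(V, ρ)` of the Arveson correspondence `E_P` on a Hilbert
space `K`: a normal `*`-representation `ρ` of `M'` and a linear bimodule map `V : E_P → B(K)`
with `V(Y)⋆V(Z) = ρ(⟨Y, Z⟩)`. (Complete contractivity and continuity of `V` follow from these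
conditions.) -/
structure IsometricRep (P : M →CP M)
    (K : Type v) [NormedAddCommGroup K] [InnerProductSpace ℂ K] [CompleteSpace K] where
  V : arveson P →ₗ[ℂ] (K →L[ℂ] K)
  ρ : M.commutant →⋆ₙₐ[ℂ] (K →L[ℂ] K)
  normal : IsNormal M.commutant ρ
  map_lact : ∀ (S : M.commutant) (Y : arveson P), V (lact P S Y) = ρ S * V Y
  map_ract : ∀ (Y : arveson P) (S : M.commutant), V (ract P Y S) = V Y * ρ S
  isometric : ∀ Y Z : arveson P, star (V Y) * V Z = ρ (arvesonInner P Y Z)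

/-- The identity covariant representation `(T, σ)` of `E_P` on `H` : the map `T`. -/
def identityT (P : M →CP M) : arveson P →ₗ[ℂ] (H →L[ℂ] H) := (arveson P).subtype

/-- The identity covariant representation `(T, σ)` of `E_P` on `H` : the map `σ`. -/
def identityσ (M : VonNeumannAlgebra H) : M.commutant →⋆ₙₐ[ℂ] (H →L[ℂ] H) :=
  NonUnitalStarSubalgebraClass.subtype M.commutant

namespace IsometricRep

variable {P : M →CP M}
variable {K : Type v} [NormedAddCommGroup K] [InnerProductSpace ℂ K] [CompleteSpace K]
variable (D : IsometricRep P K)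

/-- A closed subspace of `K` reduces `(V, ρ)` if it is invariant under all the operators `V(Y)`,
`V(Y)⋆` and `ρ(S)`. -/
def Reduces (L : Submodule ℂ K) : Prop :=
  (∀ Y, ∀ k ∈ L, D.V Y k ∈ L) ∧ (∀ Y, ∀ k ∈ L, star (D.V Y) k ∈ L) ∧ ∀ S, ∀ k ∈ L, D.ρ S k ∈ L

theorem centralizer_range : Set.centralizer (Set.range D.ρ ∪ star (Set.range D.ρ))
    = Set.centralizer (Set.range D.ρ) := by
  have : star (Set.range D.ρ) = Set.range D.ρ := by
    ext X
    constructor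
    · rintro ⟨S, hS⟩
      exact ⟨star S, by rw [map_star, hS, star_star]⟩
    · rintro ⟨S, rfl⟩
      exact ⟨star S, map_star _ _⟩
  rw [this, Set.union_self]

/-- The von Neumann algebra `R = ρ(M')'` on `K`. -/
def algebra : VonNeumannAlgebra K where
  toStarSubalgebra := StarSubalgebra.centralizer ℂ (Set.range D.ρ)
  centralizer_centralizer' := by
    change Set.centralizer (Set.centralizer
      (Set.centralizer (Set.range D.ρ ∪ star (Set.range D.ρ)))) = Set.centralizer _
    rw [Set.centralizer_centralizer_centralizer]

theorem mem_algebra {X : K →L[ℂ] K} : X ∈ D.algebra ↔ ∀ S, D.ρ S * X = X * D.ρ S := by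
  change X ∈ Set.centralizer (Set.range D.ρ ∪ star (Set.range D.ρ)) ↔ _
  rw [centralizer_range, Set.mem_centralizer_iff, Set.forall_mem_range]

/-- The form `(Y, Z) ↦ ρ(⟨Y, Z⟩)` on `E_P`. -/
def repForm : PosForm (arveson P) K where
  form := LinearMap.mk₂'ₛₗ (starRingEnd ℂ) (RingHom.id ℂ) (fun Y Z => D.ρ (arvesonInner P Y Z))
    (by intros; simp [← D.isometric, add_mul]) (by intros; simp [← D.isometric])
    (by intros; simp [← D.isometric, mul_add]) (by intros; simp [← D.isometric])
  star_form Y Z := by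
    change star (D.ρ (arvesonInner P Y Z)) = D.ρ (arvesonInner P Z Y)
    rw [← D.isometric, ← D.isometric, star_mul, star_star]
  nonneg n Y k := by
    change 0 ≤ (∑ i, ∑ j, inner ℂ (k i) (D.ρ (arvesonInner P (Y i) (Y j)) (k j))).re
    have : ∑ i, ∑ j, inner ℂ (k i) (D.ρ (arvesonInner P (Y i) (Y j)) (k j))
        = inner ℂ (∑ i, D.V (Y i) (k i)) (∑ j, D.V (Y j) (k j)) := by
      simp only [sum_inner, inner_sum]
      rw [Finset.sum_comm]
      refine Finset.sum_congr rfl fun i _ => Finset.sum_congr rfl fun j _ => ?_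
      rw [← D.isometric, mul_apply_eq_comp, ContinuousLinearMap.star_eq_adjoint,
        ContinuousLinearMap.adjoint_inner_right]
    rw [this]
    exact inner_self_nonneg (𝕜 := ℂ)

theorem repForm_apply (Y Z : arveson P) :
    D.repForm.form Y Z = D.ρ (arvesonInner P Y Z) := rfl

theorem repForm_mem (Y Z : arveson P) : D.repForm.form Y Z ∈ D.algebra.commutant := by
  rw [repForm_apply, VonNeumannAlgebra.mem_commutant_iff]
  exact fun X hX => ((D.mem_algebra.1 hX) _).symm

/-- The Hilbert space `E_P ⊗_ρ K`: the Hausdorff completion of `E_P ⊗ K` for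
`⟨Y ⊗ k, Z ⊗ l⟩ = ⟨k, ρ(⟨Y, Z⟩) l⟩`. -/
abbrev Tensor : Type max u v := D.repForm.Space

/-- `Y ⊗ k ↦ V(Y) k` on the algebraic tensor product. -/
def preTilde : D.repForm.Pre →ₗ[ℂ] K :=
  D.repForm.lift (LinearMap.mk₂ ℂ (fun Y k => D.V Y k)
    (by intros; simp) (by intros; simp) (by intros; simp) (by intros; simp))

theorem preTilde_pure (Y : arveson P) (k : K) : D.preTilde (D.repForm.pure Y k) = D.V Y k := rfl

theorem norm_preTilde_le (x : D.repForm.Pre) : ‖D.preTilde x‖ ≤ 1 * ‖x‖ := by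
  have main : ∀ x y, inner ℂ (D.preTilde x) (D.preTilde y) = D.repForm.gram x y := by
    intro x y
    induction x using PosForm.pre_induction with
    | h0 => simp
    | h2 x x' hx hx' => simp only [map_add, LinearMap.add_apply, inner_add_left, hx, hx']
    | h1 a h =>
      induction y using PosForm.pre_induction with
      | h0 => simp
      | h2 y y' hy hy' => simp only [map_add, inner_add_right, hy, hy']
      | h1 b k =>
        rw [preTilde_pure, preTilde_pure, PosForm.gram_pure, repForm_apply, ← D.isometric,
          mul_apply_eq_comp, ContinuousLinearMap.star_eq_adjoint,
          ContinuousLinearMap.adjoint_inner_right]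
  refine le_of_sq_le_sq ?_ (by positivity)
  rw [one_mul, D.repForm.norm_sq_eq, ← main, ← inner_self_eq_norm_sq (𝕜 := ℂ)]
  exact le_rfl

/-- The operator `Ṽ : E_P ⊗_ρ K → K`, `Ṽ(Y ⊗ k) = V(Y) k`. -/
def tilde : D.Tensor →L[ℂ] K :=
  (D.preTilde.mkContinuous 1 D.norm_preTilde_le).fromCompletion

theorem tilde_tmul (Y : arveson P) (k : K) : D.tilde (D.repForm.tmul Y k) = D.V Y k := by
  rw [tilde, PosForm.tmul, ContinuousLinearMap.fromCompletion_apply_coe]; rfl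

theorem adjoint_tilde_comp_tilde :
    ContinuousLinearMap.adjoint D.tilde ∘L D.tilde = ContinuousLinearMap.id ℂ _ := by
  refine PosForm.hom_ext _ fun Y k => ?_
  refine ext_inner_left ℂ fun z => ?_
  rw [ContinuousLinearMap.comp_apply, ContinuousLinearMap.adjoint_inner_right,
    ContinuousLinearMap.id_apply, ← inner_conj_symm, ← inner_conj_symm z]
  congr 1
  have e : innerSL ℂ (D.tilde (D.repForm.tmul Y k)) ∘L D.tilde
      = innerSL ℂ (D.repForm.tmul Y k) :=
    PosForm.hom_ext _ fun Z l => by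
      rw [ContinuousLinearMap.comp_apply, innerSL_apply_apply, innerSL_apply_apply, tilde_tmul,
        tilde_tmul, PosForm.inner_tmul, repForm_apply, ← D.isometric,
        mul_apply_eq_comp, ContinuousLinearMap.star_eq_adjoint,
        ContinuousLinearMap.adjoint_inner_right]
  exact DFunLike.congr_fun e z

/-- The operator `I ⊗ S` on `E_P ⊗_ρ K` for `S ∈ ρ(M')'`. -/
def idTensor (S : D.algebra) : D.Tensor →L[ℂ] D.Tensor :=
  D.repForm.right D.algebra D.repForm_mem S

/-- `Ṽ (I ⊗ S) Ṽ⋆`. -/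
def inducedAux (S : D.algebra) : K →L[ℂ] K :=
  D.tilde ∘L D.idTensor S ∘L ContinuousLinearMap.adjoint D.tilde

theorem inducedAux_comp_tilde (S : D.algebra) :
    D.inducedAux S ∘L D.tilde = D.tilde ∘L D.idTensor S := by
  rw [inducedAux, ContinuousLinearMap.comp_assoc, ContinuousLinearMap.comp_assoc,
    adjoint_tilde_comp_tilde, ContinuousLinearMap.comp_id]

theorem inducedAux_mem (S : D.algebra) : D.inducedAux S ∈ D.algebra := by
  -- `ρ(B)` intertwines `Ṽ` with the operator `Y ⊗ k ↦ BY ⊗ k`, which is `Ṽ⋆ρ(B)Ṽ`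
  have e1 : ∀ B, D.tilde ∘L (ContinuousLinearMap.adjoint D.tilde ∘L D.ρ B ∘L D.tilde)
      = D.ρ B ∘L D.tilde := by
    intro B
    refine PosForm.hom_ext _ fun Y k => ?_
    have h1 : D.ρ B (D.tilde (D.repForm.tmul Y k)) = D.tilde (D.repForm.tmul (lact P B Y) k) := by
      rw [tilde_tmul, tilde_tmul, D.map_lact]; rfl
    have h2 := DFunLike.congr_fun D.adjoint_tilde_comp_tilde (D.repForm.tmul (lact P B Y) k)
    simp only [ContinuousLinearMap.comp_apply, ContinuousLinearMap.id_apply] at h2 ⊢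
    rw [h1, h2]
  have e2 : ∀ B, ContinuousLinearMap.adjoint D.tilde ∘L D.ρ B
      = (ContinuousLinearMap.adjoint D.tilde ∘L D.ρ B ∘L D.tilde)
        ∘L ContinuousLinearMap.adjoint D.tilde := by
    intro B
    have h := congrArg ContinuousLinearMap.adjoint (e1 (star B))
    have h3 : ContinuousLinearMap.adjoint (D.ρ (star B)) = D.ρ B := by
      rw [← ContinuousLinearMap.star_eq_adjoint, map_star, star_star]
    simp only [ContinuousLinearMap.adjoint_comp, ContinuousLinearMap.adjoint_adjoint, h3] at h
    rw [← h]; rfl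
  have e3 : ∀ B, D.idTensor S ∘L (ContinuousLinearMap.adjoint D.tilde ∘L D.ρ B ∘L D.tilde)
      = (ContinuousLinearMap.adjoint D.tilde ∘L D.ρ B ∘L D.tilde) ∘L D.idTensor S := by
    intro B
    have h0 : ∀ Y k, (ContinuousLinearMap.adjoint D.tilde ∘L D.ρ B ∘L D.tilde)
        (D.repForm.tmul Y k) = D.repForm.tmul (lact P B Y) k := by
      intro Y k
      have h1 : D.ρ B (D.tilde (D.repForm.tmul Y k))
          = D.tilde (D.repForm.tmul (lact P B Y) k) := by
        rw [tilde_tmul, tilde_tmul, D.map_lact]; rfl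
      have h2 := DFunLike.congr_fun D.adjoint_tilde_comp_tilde (D.repForm.tmul (lact P B Y) k)
      simp only [ContinuousLinearMap.comp_apply, ContinuousLinearMap.id_apply] at h2 ⊢
      rw [h1, h2]
    refine PosForm.hom_ext _ fun Y k => ?_
    rw [ContinuousLinearMap.comp_apply, ContinuousLinearMap.comp_apply _ (D.idTensor S), h0,
      idTensor, PosForm.right_tmul, PosForm.right_tmul, h0]
  rw [mem_algebra]
  intro B
  change D.ρ B ∘L D.inducedAux S = D.inducedAux S ∘L D.ρ B
  rw [inducedAux, ← ContinuousLinearMap.comp_assoc, ← e1, ContinuousLinearMap.comp_assoc,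
    ← ContinuousLinearMap.comp_assoc _ (D.idTensor S), ← e3, ContinuousLinearMap.comp_assoc]
  change _ = D.tilde ∘L D.idTensor S ∘L (ContinuousLinearMap.adjoint D.tilde ∘L D.ρ B)
  rw [e2 B]

/-- The induced map `Θ_V : R → R`, `Θ_V(S) = Ṽ (I ⊗ S) Ṽ⋆`, on `R = ρ(M')'`. -/
def induced (S : D.algebra) : D.algebra := ⟨D.inducedAux S, D.inducedAux_mem S⟩

end IsometricRep

/-- A minimal isometric dilation of a pair `(T, σ)`, where `T : E_P → B(H)` is linear and `σ` is a
`*`-representation of `M'` on `H`: an isometric covariant representation `(V, ρ)` of `E_P` on `K`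
together with an isometric embedding `W : H → K` such that
* the projection `WW⋆` onto `WH` commutes with `ρ(M')` and `ρ` restricts to `σ` on `H`,
* every `V(Y)⋆` leaves `WH` invariant and the compression of `V(Y)` to `H` is `T(Y)`,
* the smallest closed subspace that contains `WH` and reduces `(V, ρ)` is `K`. -/
structure MinimalIsometricDilation (P : M →CP M) (T : arveson P →ₗ[ℂ] (H →L[ℂ] H))
    (σ : M.commutant →⋆ₙₐ[ℂ] (H →L[ℂ] H))
    (K : Type v) [NormedAddCommGroup K] [InnerProductSpace ℂ K] [CompleteSpace K]
    extends IsometricRep P K where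
  W : H →L[ℂ] K
  isometry_W : ∀ h, ‖W h‖ = ‖h‖
  commute_proj : ∀ S, (W ∘L ContinuousLinearMap.adjoint W) * ρ S
    = ρ S * (W ∘L ContinuousLinearMap.adjoint W)
  restrict : ∀ S, ρ S ∘L W = W ∘L σ S
  invariant : ∀ Y h, star (V Y) (W h) ∈ LinearMap.range W.toLinearMap
  compress : ∀ Y, ContinuousLinearMap.adjoint W ∘L V Y ∘L W = T Y
  minimal : ∀ L : Submodule ℂ K, IsClosed (L : Set K) → (∀ h, W h ∈ L) →
    toIsometricRep.Reduces L → L = ⊤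

end Rep

end

end ArvesonDilation

open scoped CStarAlgebra
open ArvesonDilation

/-! The map `Y ↦ Φ_Y⋆` identifies `E_P` with the operators `H → M ⊗_P H` that intertwine the
identity representation of `M` with the Stinespring representation `π_P` (`adjoint_phi_intertwines`,
`exists_phi_eq_adjoint`). Normality of `P` makes the ranges of these operators jointly total
(`mem_of_adjoint_phi_mem`), and both halves of the theorem rest on this density.

Normality is handled through domination. A vector `k` is dominated for a `*`-representation `f` if
`‖f(A)k‖ ≤ ‖(A ⊗ 1)ζ‖` for some `ζ ∈ ℓ²(ℕ, H)`. Then `(A ⊗ 1)ζ ↦ f(A)k` extends to an intertwiner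
`ℓ²(ℕ, H) → K`, whose restrictions to the coordinates are intertwiners `H → K`. Dominated vectors
form a closed subspace (`isClosed_dominated`), and `f` is normal exactly when they fill `K`
(`IsNormal.dominated_eq_top`, `isNormal_of_dominated`). So normality need only be tested on a total
set.

Existence: the dilation lives on the inductive limit of `M ⊗_P ⋯ ⊗_P M ⊗_P H`, where appending a
letter `1` is isometric because `P 1 = 1`. Concretely it is the space of the kernel `pathKernel`,
whose positivity is complete positivity applied once per letter (`pathKernel_matrix_nonneg`). The
commutant `M'` acts on the factor `H`, and `V(Y)` replaces that factor by `M ⊗_P H` through `Φ_Y⋆`.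
Totality of the vectors `Φ_Y⋆ h` gives minimality.

Structure: since `ρ` is normal and, by minimality, unital, `K` is spanned by ranges of intertwiners
`Z : H → K`. Each `ZW⋆` lies in `R`, so an element of `R'` is determined by its corner, which lies
in `M'`; hence `R' = ρ(M')`.

Power dilation: let `U : E_P ⊗_ρ K → M ⊗_P H` be `Y ⊗ k ↦ Φ_Y⋆ W⋆ k`. Then `Ṽ⋆ W h = U⋆(1 ⊗ h)` and
`U (I ⊗ S) U⋆ = π_P(W⋆SW)`, so `W⋆ Θ_V(S) W = P(W⋆SW)` for every `S` in `R` (`map_compress`), and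
this iterates. With `S = 1` it shows that the range of `Ṽ` contains `WH`; by minimality `Ṽ` is
unitary, so `Θ_V` is unital. It is multiplicative because `Ṽ⋆Ṽ = 1`, and normal because `Θ_V(S)V(Y)
= V(Y)S` dominates every vector `V(Y)k`. -/

namespace ArvesonDilation

open scoped ComplexOrder Topology

noncomputable section

/-! ### The amplification of operators to `ℓ²(ℕ, H)` -/

section Amplification

variable {H : Type u} [NormedAddCommGroup H] [InnerProductSpace ℂ H]

/-- The Hilbert space `ℓ²(ℕ, H)`. -/
abbrev Ampl (H : Type u) [NormedAddCommGroup H] : Type u := lp (fun _ : ℕ => H) 2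

omit [InnerProductSpace ℂ H] in
theorem Ampl.hasSum_norm_sq (x : Ampl H) : HasSum (fun n => ‖x n‖ ^ 2) (‖x‖ ^ 2) := by
  have := lp.hasSum_norm (E := fun _ : ℕ => H) (p := 2) (by norm_num) x
  simpa using this

omit [InnerProductSpace ℂ H] in
theorem Ampl.norm_sq (x : Ampl H) : ‖x‖ ^ 2 = ∑' n, ‖x n‖ ^ 2 := (hasSum_norm_sq x).tsum_eq.symm

omit [InnerProductSpace ℂ H] in
theorem memℓp_two_iff {x : ℕ → H} : Memℓp x 2 ↔ Summable fun n => ‖x n‖ ^ 2 := by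
  rw [memℓp_gen_iff (by norm_num)]
  simp

theorem summable_norm_sq_apply {x : ℕ → H} (hx : Summable fun n => ‖x n‖ ^ 2) {K : Type v}
    [NormedAddCommGroup K] [NormedSpace ℂ K] (T : H →L[ℂ] K) :
    Summable fun n => ‖T (x n)‖ ^ 2 := by
  refine Summable.of_nonneg_of_le (fun n => by positivity) (fun n => ?_) (hx.mul_left (‖T‖ ^ 2))
  rw [← mul_pow]
  gcongr
  exact T.le_opNorm _

/-- The vector of `ℓ²(ℕ, H)` with a given square-summable sequence of coordinates. -/
def Ampl.mk (x : ℕ → H) (hx : Summable fun n => ‖x n‖ ^ 2) : Ampl H := ⟨x, memℓp_two_iff.2 hx⟩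

omit [InnerProductSpace ℂ H] in
theorem Ampl.mk_apply (x : ℕ → H) (hx : Summable fun n => ‖x n‖ ^ 2) (n : ℕ) :
    Ampl.mk x hx n = x n := rfl

omit [InnerProductSpace ℂ H] in
theorem Ampl.summable (x : Ampl H) : Summable fun n => ‖x n‖ ^ 2 := (hasSum_norm_sq x).summable

/-- The amplification `T ⊗ 1` of an operator `T` to `ℓ²(ℕ, H)`. -/
def amplify (T : H →L[ℂ] H) : Ampl H →L[ℂ] Ampl H :=
  LinearMap.mkContinuous
    { toFun := fun x => Ampl.mk (fun n => T (x n)) (summable_norm_sq_apply x.summable T)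
      map_add' := fun x y => by ext n; simp [Ampl.mk_apply]
      map_smul' := fun c x => by ext n; simp [Ampl.mk_apply] } ‖T‖ (fun x => by
    refine le_of_sq_le_sq ?_ (by positivity)
    rw [mul_pow, Ampl.norm_sq, Ampl.norm_sq, ← tsum_mul_left]
    refine Summable.tsum_le_tsum (fun n => ?_) (Ampl.summable _) (x.summable.mul_left _)
    rw [← mul_pow]
    exact pow_le_pow_left₀ (norm_nonneg _) (T.le_opNorm _) 2)

@[simp] theorem amplify_apply (T : H →L[ℂ] H) (x : Ampl H) (n : ℕ) : amplify T x n = T (x n) := rfl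

theorem norm_sq_amplify (T : H →L[ℂ] H) (x : Ampl H) :
    ‖amplify T x‖ ^ 2 = ∑' n, ‖T (x n)‖ ^ 2 := Ampl.norm_sq _

/-- The amplification as a `*`-representation of `B(H)`. -/
def amplifyHom [CompleteSpace H] : (H →L[ℂ] H) →⋆ₙₐ[ℂ] (Ampl H →L[ℂ] Ampl H) where
  toFun := amplify
  map_smul' c T := by ext x n; simp
  map_zero' := by ext x n; simp
  map_add' S T := by ext x n; simp
  map_mul' S T := by ext x n; simp
  map_star' T := by
    symm
    rw [ContinuousLinearMap.star_eq_adjoint, eq_comm, ContinuousLinearMap.eq_adjoint_iff]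
    intro x y
    rw [lp.inner_eq_tsum, lp.inner_eq_tsum]
    refine tsum_congr fun n => ?_
    rw [amplify_apply, amplify_apply, ContinuousLinearMap.star_eq_adjoint,
      ContinuousLinearMap.adjoint_inner_left]

end Amplification

/-! ### Intertwiners from dominated vector functionals -/

section Intertwiner

variable {A : Type w} [Ring A] [StarRing A] [Algebra ℂ A]
variable {E : Type u} [NormedAddCommGroup E] [InnerProductSpace ℂ E] [CompleteSpace E]
variable {F : Type v} [NormedAddCommGroup F] [InnerProductSpace ℂ F] [CompleteSpace F]

/-- If `‖b(T)k‖ ≤ ‖a(T)ζ‖` for two `*`-representations `a` and `b`, then `a(T)ζ ↦ b(T)k` extends to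
an operator that intertwines `a` and `b`. -/
theorem exists_intertwiner (a : A →⋆ₙₐ[ℂ] (E →L[ℂ] E)) (b : A →⋆ₙₐ[ℂ] (F →L[ℂ] F)) (ζ : E) (k : F)
    (h : ∀ T, ‖b T k‖ ≤ ‖a T ζ‖) :
    ∃ X : E →L[ℂ] F, (∀ T, X (a T ζ) = b T k) ∧ ∀ T, X ∘L a T = b T ∘L X := by
  let e : A →ₗ[ℂ] E :=
    { toFun := fun T => a T ζ, map_add' := by intros; simp, map_smul' := by intros; simp }
  let f : A →ₗ[ℂ] F :=
    { toFun := fun T => b T k, map_add' := by intros; simp, map_smul' := by intros; simp }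
  let S : Submodule ℂ E := (LinearMap.range e).topologicalClosure
  have hSc : IsClosed (S : Set E) := Submodule.isClosed_topologicalClosure _
  have : CompleteSpace S := hSc.completeSpace_coe
  have heS : ∀ T, e T ∈ S := fun T => Submodule.le_topologicalClosure _ ⟨T, rfl⟩
  let e' : A →ₗ[ℂ] S := e.codRestrict S heS
  have hd : DenseRange e' := by
    intro x
    have hx : (x : E) ∈ closure (Set.range e) := x.2
    rw [closure_subtype]
    convert hx using 2
    ext y
    constructor
    · rintro ⟨_, ⟨T, rfl⟩, rfl⟩; exact ⟨T, rfl⟩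
    · rintro ⟨T, rfl⟩; exact ⟨e' T, ⟨T, rfl⟩, rfl⟩
  have hn : ∃ C : ℝ, ∀ T, ‖f T‖ ≤ C * ‖e' T‖ := ⟨1, fun T => by rw [one_mul]; exact h T⟩
  let Y : S →L[ℂ] F := f.extendOfNorm e'
  have hY : ∀ T, Y (e' T) = f T := fun T => LinearMap.extendOfNorm_eq hd hn T
  -- Extension by zero on `Sᗮ` preserves the intertwining relation, since `Sᗮ` is invariant too: `S`
  -- is invariant under a self-adjoint family.
  let X : E →L[ℂ] F := Y ∘L S.orthogonalProjectionOnto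
  have hXS : ∀ x : S, X x = Y x := fun x => by
    change Y (S.orthogonalProjectionOnto x) = Y x
    simp
  have hXo : ∀ x ∈ Sᗮ, X x = 0 := fun x hx => by
    change Y (S.orthogonalProjectionOnto x) = 0
    rw [Submodule.orthogonalProjectionOnto_eq_zero_iff.2 hx, map_zero]
  have hXe : ∀ T, X (a T ζ) = b T k := fun T => (hXS (e' T)).trans (hY T)
  have hinv : ∀ T, ∀ x ∈ S, a T x ∈ S := by
    intro T x hx
    have : S ≤ S.comap (a T : E →ₗ[ℂ] E) := by
      refine Submodule.topologicalClosure_minimal _ ?_ (hSc.preimage (a T).continuous)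
      rintro _ ⟨R, rfl⟩
      change a T (a R ζ) ∈ S
      have := heS (T * R)
      change a (T * R) ζ ∈ S at this
      rwa [map_mul] at this
    exact this hx
  have hinvo : ∀ T, ∀ x ∈ Sᗮ, a T x ∈ Sᗮ := by
    intro T x hx
    rw [Submodule.mem_orthogonal]
    intro y hy
    have := (Submodule.mem_orthogonal _ _).1 hx _ (hinv (star T) y hy)
    rwa [map_star, ContinuousLinearMap.star_eq_adjoint,
      ContinuousLinearMap.adjoint_inner_left] at this
  refine ⟨X, hXe, fun T => ?_⟩
  have hS : ∀ x ∈ S, X (a T x) = b T (X x) := by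
    intro x hx
    have hcl : IsClosed {x | X (a T x) = b T (X x)} :=
      isClosed_eq (X.continuous.comp (a T).continuous) ((b T).continuous.comp X.continuous)
    refine closure_minimal ?_ hcl (show x ∈ closure (Set.range e) from hx)
    rintro _ ⟨R, rfl⟩
    change X (a T (a R ζ)) = b T (X (a R ζ))
    have := hXe (T * R)
    rw [map_mul, map_mul] at this
    rw [hXe]
    exact this
  ext x
  obtain ⟨y, hy, z, hz, rfl⟩ := S.exists_add_mem_mem_orthogonal x
  simp only [ContinuousLinearMap.comp_apply, map_add]
  rw [hS y hy, hXo _ (hinvo T z hz), hXo z hz, map_zero]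

/-- A vector functional of `b` that is dominated by a vector functional of `a` is itself a vector
functional of `a`. -/
theorem exists_norm_eq (a : A →⋆ₙₐ[ℂ] (E →L[ℂ] E)) (b : A →⋆ₙₐ[ℂ] (F →L[ℂ] F)) (ζ : E) (k : F)
    (h : ∀ T, ‖b T k‖ ≤ ‖a T ζ‖) : ∃ ζ' : E, ∀ T, ‖a T ζ'‖ = ‖b T k‖ := by
  obtain ⟨X, hX, hXi⟩ := exists_intertwiner a b ζ k h
  -- `G = X⋆X` commutes with `a`, hence so does `√G`, and `‖a(T)√G ζ‖ = ‖√G a(T)ζ‖ = ‖X a(T)ζ‖ =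
  -- ‖b(T)k‖`.
  let G : E →L[ℂ] E := ContinuousLinearMap.adjoint X ∘L X
  have hG : 0 ≤ G := by
    rw [ContinuousLinearMap.nonneg_iff_isPositive]
    exact ContinuousLinearMap.isPositive_adjoint_comp_self X
  have hstar : ∀ T, ContinuousLinearMap.adjoint X ∘L b T = a T ∘L ContinuousLinearMap.adjoint X := by
    intro T
    have := congrArg ContinuousLinearMap.adjoint (hXi (star T))
    rw [ContinuousLinearMap.adjoint_comp, ContinuousLinearMap.adjoint_comp,
      ← ContinuousLinearMap.star_eq_adjoint (a _), ← ContinuousLinearMap.star_eq_adjoint (b _),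
      ← map_star, ← map_star, star_star] at this
    exact this.symm
  have hc : ∀ T, Commute G (a T) := by
    intro T
    change (ContinuousLinearMap.adjoint X ∘L X) ∘L a T = a T ∘L (ContinuousLinearMap.adjoint X ∘L X)
    rw [ContinuousLinearMap.comp_assoc, hXi, ← ContinuousLinearMap.comp_assoc, hstar]
    rfl
  have hc' : ∀ T, CFC.sqrt G * a T = a T * CFC.sqrt G := fun T => by
    rw [CFC.sqrt_eq_cfc]
    exact ((hc T).cfc_nnreal _).eq
  refine ⟨CFC.sqrt G ζ, fun T => ?_⟩
  have e : a T (CFC.sqrt G ζ) = CFC.sqrt G (a T ζ) := (DFunLike.congr_fun (hc' T) ζ).symm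
  rw [← sq_eq_sq₀ (norm_nonneg _) (norm_nonneg _), e, ← hX T,
    ← inner_self_eq_norm_sq (𝕜 := ℂ), ← inner_self_eq_norm_sq (𝕜 := ℂ)]
  congr 1
  rw [← ContinuousLinearMap.adjoint_inner_right, ← ContinuousLinearMap.adjoint_inner_right X,
    ← ContinuousLinearMap.star_eq_adjoint, (CFC.sqrt_nonneg G).isSelfAdjoint.star_eq]
  congr 1
  exact DFunLike.congr_fun (CFC.sqrt_mul_sqrt_self G hG) (a T ζ)

end Intertwiner

/-! ### Sums and multiples of vector functionals on the amplification -/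

section Majorize

variable {H : Type u} [NormedAddCommGroup H] [InnerProductSpace ℂ H]

/-- Countably many vectors of `ℓ²(ℕ, H)` with summable squared norms can be merged into one. -/
theorem exists_norm_sq_amplify_eq_tsum (ζ : ℕ → Ampl H) (hζ : Summable fun j => ‖ζ j‖ ^ 2) :
    ∃ ξ : Ampl H, ∀ T : H →L[ℂ] H, ‖amplify T ξ‖ ^ 2 = ∑' j, ‖amplify T (ζ j)‖ ^ 2 := by
  have hs : Summable fun p : ℕ × ℕ => ‖ζ p.1 p.2‖ ^ 2 := by
    rw [summable_prod_of_nonneg fun p => by positivity]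
    refine ⟨fun j => (ζ j).summable, ?_⟩
    simpa only [← Ampl.norm_sq] using hζ
  obtain ⟨e⟩ : Nonempty (ℕ ≃ ℕ × ℕ) := ⟨Nat.pairEquiv.symm⟩
  have hs' : Summable fun n => ‖ζ (e n).1 (e n).2‖ ^ 2 := e.summable_iff.2 hs
  refine ⟨Ampl.mk (fun n => ζ (e n).1 (e n).2) hs', fun T => ?_⟩
  have hT : Summable fun p : ℕ × ℕ => ‖T (ζ p.1 p.2)‖ ^ 2 := by
    refine Summable.of_nonneg_of_le (fun n => by positivity) (fun n => ?_) (hs.mul_left (‖T‖ ^ 2))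
    rw [← mul_pow]
    gcongr
    exact T.le_opNorm _
  rw [norm_sq_amplify]
  change ∑' n, ‖T (ζ (e n).1 (e n).2)‖ ^ 2 = _
  rw [e.tsum_eq (fun p : ℕ × ℕ => ‖T (ζ p.1 p.2)‖ ^ 2), hT.tsum_prod]
  simp only [norm_sq_amplify]

/-- Lets finitely many σ-weak conditions on `A⋆A` be replaced by a condition on one vector. -/
theorem exists_norm_sq_amplify_eq_add (ζ ζ' : Ampl H) :
    ∃ ξ : Ampl H, ∀ T : H →L[ℂ] H,
      ‖amplify T ξ‖ ^ 2 = ‖amplify T ζ‖ ^ 2 + ‖amplify T ζ'‖ ^ 2 := by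
  let z : ℕ → Ampl H := fun j => if j = 0 then ζ else if j = 1 then ζ' else 0
  have hz : ∀ j ∉ Finset.range 2, z j = 0 := fun j hj => by
    have : 2 ≤ j := not_lt.1 fun h => hj (Finset.mem_range.2 h)
    simp only [z]
    rw [if_neg (by omega), if_neg (by omega)]
  obtain ⟨ξ, h⟩ := exists_norm_sq_amplify_eq_tsum z
    (summable_of_ne_finset_zero (s := Finset.range 2) fun j hj => by simp [hz j hj])
  refine ⟨ξ, fun T => ?_⟩
  rw [h, tsum_eq_sum (s := Finset.range 2) fun j hj => by simp [hz j hj]]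
  simp [Finset.sum_range_succ, z]

theorem exists_norm_sq_amplify_eq_mul (ζ : Ampl H) {c : ℝ} (hc : 0 ≤ c) :
    ∃ ξ : Ampl H, ∀ T : H →L[ℂ] H, ‖amplify T ξ‖ ^ 2 = c * ‖amplify T ζ‖ ^ 2 := by
  refine ⟨((√c : ℝ) : ℂ) • ζ, fun T => ?_⟩
  rw [map_smul, norm_smul, mul_pow]
  simp [Real.sq_sqrt hc]

end Majorize

/-! ### Normality of a representation as domination of its vectors -/

section Normal

variable {H : Type u} [NormedAddCommGroup H] [InnerProductSpace ℂ H] [CompleteSpace H]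
variable {K : Type v} [NormedAddCommGroup K] [InnerProductSpace ℂ K] [CompleteSpace K]
variable {M : VonNeumannAlgebra H}

omit [CompleteSpace H] in
theorem continuous_sigmaWeak_tsum (ξ η : Ampl H) :
    @Continuous (H →L[ℂ] H) ℂ (sigmaWeak H) _ fun T => ∑' n, inner ℂ (η n) (T (ξ n)) :=
  continuous_iInf_dom (i := ⟨(ξ, η), ξ.summable, η.summable⟩) continuous_induced_dom

theorem inner_amplify_star_mul (A : H →L[ℂ] H) (ξ η : Ampl H) :
    ∑' n, inner ℂ (η n) ((star A * A) (ξ n)) = inner ℂ (amplify A η) (amplify A ξ) := by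
  rw [lp.inner_eq_tsum]
  refine tsum_congr fun n => ?_
  rw [amplify_apply, amplify_apply, mul_apply_eq_comp, ContinuousLinearMap.star_eq_adjoint,
    ContinuousLinearMap.adjoint_inner_right]

omit [CompleteSpace K] in
/-- The functional `A ↦ ⟨k, f(A⋆A)k⟩` for a normal map `f` is dominated by `∑ ‖Aζₙ‖²` for some
square-summable sequence `ζ`. -/
theorem IsNormal.exists_le {f : M →ₗ[ℂ] (K →L[ℂ] K)} (hf : IsNormal M f) (k : K) :
    ∃ ζ : Ampl H, ∀ A : M, ‖inner ℂ k (f (star A * A) k)‖ ≤ ‖amplify A ζ‖ ^ 2 := by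
  classical
  let τ : TopologicalSpace M := TopologicalSpace.induced Subtype.val (sigmaWeak H)
  let φ : M → ℂ := fun T => inner ℂ k (f T k)
  have hφ : @Continuous M ℂ τ _ φ := by
    have h1 := (continuous_sigmaWeak_tsum (lp.single 2 0 k) (lp.single 2 0 k : Ampl K))
    have h2 := @Continuous.comp M (K →L[ℂ] K) ℂ τ (sigmaWeak K) _ _ _ h1 hf
    convert h2 using 1
    funext T
    rw [Function.comp_apply, tsum_eq_single 0]
    · simp [φ]
    · intro n hn
      simp [lp.single_apply, hn]
  have hnhds : {T : M | ‖φ T‖ < 1} ∈ @nhds M τ 0 := by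
    have hopen : @IsOpen M τ {T : M | ‖φ T‖ < 1} :=
      @IsOpen.preimage M ℂ τ _ φ hφ _ (isOpen_lt continuous_norm continuous_const)
    exact @IsOpen.mem_nhds M τ _ _ hopen (by simp [φ])
  have key : ∃ ζ : Ampl H, ∀ A : M, ‖amplify (A : H →L[ℂ] H) ζ‖ ^ 2 < 1 →
      star A * A ∈ {T : M | ‖φ T‖ < 1} := by
    have hτ : τ = ⨅ p : {p : (ℕ → H) × (ℕ → H) //
        Summable (fun n => ‖p.1 n‖ ^ 2) ∧ Summable (fun n => ‖p.2 n‖ ^ 2)},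
        TopologicalSpace.induced (fun T : M =>
          ∑' n, inner ℂ (p.1.2 n) ((T : H →L[ℂ] H) (p.1.1 n))) inferInstance := by
      simp only [τ, induced_iInf, induced_compose]
      rfl
    rw [hτ, nhds_iInf] at hnhds
    -- A σ-weak neighbourhood of `0` involves finitely many defining functionals; they are absorbed
    -- into `ζ` one at a time.
    refine Filter.iInf_sets_induct (p := fun s => ∃ ζ : Ampl H, ∀ A : M,
      ‖amplify (A : H →L[ℂ] H) ζ‖ ^ 2 < 1 → star A * A ∈ s) hnhds ⟨0, by simp⟩ ?_
    rintro ⟨⟨ξ, η⟩, hξ, hη⟩ s₁ s₂ h₁ ⟨ζ₂, h₂⟩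
    rw [nhds_induced, Filter.mem_comap] at h₁
    obtain ⟨t, ht, hts⟩ := h₁
    simp only [ZeroMemClass.coe_zero, zero_apply, inner_zero_right, tsum_zero] at ht
    obtain ⟨ε, hε, hεt⟩ := Metric.mem_nhds_iff.1 ht
    -- The vector `ζ` is built so that `‖Aζ‖² = ε⁻¹(‖Aξ‖² + ‖Aη‖²) + ‖Aζ₂‖²`. If this is less than
    -- `1`, Cauchy–Schwarz gives `|⟨Aη, Aξ⟩| < ε`, and the condition for `ζ₂` is retained.
    obtain ⟨ζ₁, h₁⟩ := exists_norm_sq_amplify_eq_add (Ampl.mk ξ hξ) (Ampl.mk η hη)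
    obtain ⟨ζ₃, h₃⟩ := exists_norm_sq_amplify_eq_mul ζ₁ (c := ε⁻¹) (by positivity)
    obtain ⟨ζ, h⟩ := exists_norm_sq_amplify_eq_add ζ₃ ζ₂
    refine ⟨ζ, fun A hA => ⟨hts (hεt ?_), h₂ A ?_⟩⟩
    · rw [mem_ball_zero_iff]
      have e := inner_amplify_star_mul (A : H →L[ℂ] H) (Ampl.mk ξ hξ) (Ampl.mk η hη)
      change ‖∑' n, inner ℂ (η n) ((star (A : H →L[ℂ] H) * A) (ξ n))‖ < ε
      simp only [Ampl.mk_apply] at e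
      rw [e]
      have h4 : ε⁻¹ * (‖amplify (A : H →L[ℂ] H) (Ampl.mk ξ hξ)‖ ^ 2
          + ‖amplify (A : H →L[ℂ] H) (Ampl.mk η hη)‖ ^ 2) < 1 := by
        rw [← h₁, ← h₃]
        nlinarith [h A, sq_nonneg ‖amplify (A : H →L[ℂ] H) ζ₂‖]
      rw [inv_mul_lt_iff₀ hε, mul_one] at h4
      refine (norm_inner_le_norm _ _).trans_lt ?_
      nlinarith [sq_nonneg (‖amplify (A : H →L[ℂ] H) (Ampl.mk ξ hξ)‖
          - ‖amplify (A : H →L[ℂ] H) (Ampl.mk η hη)‖),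
        sq_nonneg ‖amplify (A : H →L[ℂ] H) (Ampl.mk ξ hξ)‖,
        sq_nonneg ‖amplify (A : H →L[ℂ] H) (Ampl.mk η hη)‖]
    · nlinarith [h A, sq_nonneg ‖amplify (A : H →L[ℂ] H) ζ₃‖]
  obtain ⟨ζ, hζ⟩ := key
  refine ⟨ζ, fun A => ?_⟩
  by_contra! hlt
  set m : ℝ := ‖inner ℂ k (f (star A * A) k)‖ with hm
  have hm0 : 0 < m := lt_of_le_of_lt (by positivity) hlt
  have hc : ((√m)⁻¹ : ℝ) ^ 2 = m⁻¹ := by rw [inv_pow, Real.sq_sqrt hm0.le]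
  -- Homogeneity: `m^(-1/2) A` satisfies the hypothesis of `hζ`, while the functional takes a value
  -- of modulus exactly `1` there.
  have h1 := hζ ((((√m)⁻¹ : ℝ) : ℂ) • A) (by
    have : amplify ((((((√m)⁻¹ : ℝ) : ℂ) • A : M)) : H →L[ℂ] H) ζ
        = (((√m)⁻¹ : ℝ) : ℂ) • amplify (A : H →L[ℂ] H) ζ := by
      ext n; simp
    rw [this, norm_smul, mul_pow, Complex.norm_real, Real.norm_eq_abs, sq_abs, hc,
      inv_mul_lt_iff₀ hm0, mul_one]
    exact hlt)
  have h2 : star ((((√m)⁻¹ : ℝ) : ℂ) • A) * ((((√m)⁻¹ : ℝ) : ℂ) • A)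
      = ((m⁻¹ : ℝ) : ℂ) • (star A * A) := by
    rw [star_smul, smul_mul_smul_comm, ← hc]
    simp [sq]
  change ‖inner ℂ k (f _ k)‖ < 1 at h1
  rw [h2, map_smul, smul_apply, inner_smul_right, norm_mul, ← hm, Complex.norm_real,
    Real.norm_of_nonneg (by positivity), inv_mul_cancel₀ hm0.ne'] at h1
  exact lt_irrefl _ h1

/-- The amplification to `ℓ²(ℕ, H)` of the identity representation of `M`. -/
def amplifyRep (M : VonNeumannAlgebra H) : M →⋆ₙₐ[ℂ] (Ampl H →L[ℂ] Ampl H) :=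
  amplifyHom.comp (NonUnitalStarSubalgebraClass.subtype M)

/-- The vectors `k` such that `‖f(A)k‖² ≤ ∑ ‖Aζₙ‖²` for some square-summable sequence `ζ`. -/
def dominated (f : M →⋆ₙₐ[ℂ] (K →L[ℂ] K)) : Submodule ℂ K where
  carrier := {k | ∃ ζ : Ampl H, ∀ A : M, ‖f A k‖ ≤ ‖amplify A ζ‖}
  zero_mem' := ⟨0, by simp⟩
  add_mem' := by
    rintro k l ⟨ζ, hζ⟩ ⟨ξ, hξ⟩
    obtain ⟨z, hz⟩ := exists_norm_sq_amplify_eq_add ζ ξ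
    -- The factor `2` comes from `(a + b)² ≤ 2(a² + b²)`.
    obtain ⟨z', hz'⟩ := exists_norm_sq_amplify_eq_mul z (c := 2) (by norm_num)
    refine ⟨z', fun A => le_of_sq_le_sq ?_ (norm_nonneg _)⟩
    rw [hz', hz, map_add]
    have h1 := norm_add_le (f A k) (f A l)
    have h2 := hζ A
    have h3 := hξ A
    nlinarith [norm_nonneg (f A k + f A l), sq_nonneg (‖amplify (A : H →L[ℂ] H) ζ‖
      - ‖amplify (A : H →L[ℂ] H) ξ‖)]
  smul_mem' := by
    rintro c k ⟨ζ, hζ⟩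
    refine ⟨c • ζ, fun A => ?_⟩
    rw [map_smul, map_smul, norm_smul, norm_smul]
    exact mul_le_mul_of_nonneg_left (hζ A) (norm_nonneg c)

theorem mem_dominated {f : M →⋆ₙₐ[ℂ] (K →L[ℂ] K)} {k : K} :
    k ∈ dominated f ↔ ∃ ζ : Ampl H, ∀ A : M, ‖f A k‖ ≤ ‖amplify A ζ‖ := Iff.rfl

theorem mem_dominated_of_le {f : M →⋆ₙₐ[ℂ] (K →L[ℂ] K)} {k : K} (h : H) (C : ℝ)
    (hle : ∀ A : M, ‖f A k‖ ≤ C * ‖(A : H →L[ℂ] H) h‖) : k ∈ dominated f := by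
  classical
  refine ⟨lp.single 2 0 ((C : ℂ) • h), fun A => (hle A).trans ?_⟩
  have e : amplify (A : H →L[ℂ] H) (lp.single 2 0 ((C : ℂ) • h))
      = lp.single 2 0 ((A : H →L[ℂ] H) ((C : ℂ) • h)) := by
    ext n
    rcases eq_or_ne n 0 with rfl | hn
    · simp
    · simp [lp.single_apply, hn]
  rw [e, lp.norm_single (by norm_num), map_smul, norm_smul, Complex.norm_real]
  gcongr
  exact Real.le_norm_self C

/-- Equality at `A = 1` bounds `‖ζ‖` by `‖f 1‖ ‖k‖`; a mere dominating vector could be arbitrarily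
long, and infinitely many of them could not be merged. -/
theorem exists_norm_amplify_eq {f : M →⋆ₙₐ[ℂ] (K →L[ℂ] K)} {k : K} (hk : k ∈ dominated f) :
    ∃ ζ : Ampl H, ∀ A : M, ‖amplify A ζ‖ = ‖f A k‖ := by
  obtain ⟨ζ, hζ⟩ := hk
  exact exists_norm_eq (amplifyRep M) f ζ k hζ

omit [CompleteSpace H] in
theorem amplify_one (ζ : Ampl H) : amplify (1 : H →L[ℂ] H) ζ = ζ := rfl

/-- Cauchy–Schwarz with weights `2⁻ʲ`, whose total is `2`. -/
theorem sq_sum_range_le (a : ℕ → ℝ) (n : ℕ) :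
    (∑ j ∈ Finset.range n, a j) ^ 2 ≤ 2 * ∑ j ∈ Finset.range n, 2 ^ j * a j ^ 2 := by
  have h := Finset.sum_sq_le_sum_mul_sum_of_sq_le_mul (Finset.range n) (r := a)
    (f := fun j => (1 / 2 : ℝ) ^ j) (g := fun j => 2 ^ j * a j ^ 2)
    (fun i _ => by positivity) (fun i _ => by positivity) (fun i _ => by
      rw [← mul_assoc, ← mul_pow]; norm_num)
  refine h.trans (mul_le_mul_of_nonneg_right ?_ (Finset.sum_nonneg fun i _ => by positivity))
  calc _ ≤ ∑' j, (1 / 2 : ℝ) ^ j :=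
        summable_geometric_two.sum_le_tsum _ fun i _ => by positivity
    _ = 2 := tsum_geometric_two

/-- A limit of dominated vectors is a series `∑ vⱼ` of dominated vectors with `‖vⱼ‖ < 2⁻ʲ` for `j ≥
1`. If `ζⱼ` represents `vⱼ`, the vectors `√(2ʲ⁺¹) ζⱼ` are still square-summable, and by the weighted
Cauchy–Schwarz inequality their merger dominates the sum. -/
theorem isClosed_dominated (f : M →⋆ₙₐ[ℂ] (K →L[ℂ] K)) : IsClosed (dominated f : Set K) := by
  refine isClosed_of_closure_subset fun k hk => ?_
  obtain ⟨v, hv, hmem, -, hlt⟩ := controlled_sum_of_mem_closure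
    (s := (dominated f).toAddSubgroup) hk (b := fun j => (1 / 2 : ℝ) ^ j)
    (fun j => by positivity)
  choose ζ hζ using fun j => exists_norm_amplify_eq (hmem j)
  have hle : ∀ j, ‖ζ j‖ ≤ ‖f 1‖ * ‖v j‖ := fun j => by
    rw [← amplify_one (ζ j)]
    exact (hζ j 1).trans_le ((f 1).le_opNorm _)
  have hpow : ∀ j, ‖((√(2 ^ (j + 1)) : ℝ) : ℂ)‖ ^ 2 = 2 * 2 ^ j := fun j => by
    rw [Complex.norm_real, Real.norm_eq_abs, sq_abs, Real.sq_sqrt (by positivity), pow_succ']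
  have hs : Summable fun j => ‖((√(2 ^ (j + 1)) : ℝ) : ℂ) • ζ j‖ ^ 2 := by
    -- The first term `v 0` approximates the limit itself and is not small, so the geometric bound
    -- starts at index `1`.
    rw [← summable_nat_add_iff 1]
    refine Summable.of_nonneg_of_le (fun j => by positivity) (fun j => ?_)
      ((summable_geometric_two).mul_left (‖f 1‖ ^ 2 * 2))
    rw [norm_smul, mul_pow, hpow]
    have h1 := hle (j + 1)
    have h2 : ‖v (j + 1)‖ ≤ (1 / 2 : ℝ) ^ (j + 1) := (hlt (j + 1) (by omega)).le
    have h3 : ‖ζ (j + 1)‖ ^ 2 ≤ (‖f 1‖ * (1 / 2 : ℝ) ^ (j + 1)) ^ 2 :=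
      pow_le_pow_left₀ (norm_nonneg _) (h1.trans (by gcongr)) 2
    calc 2 * 2 ^ (j + 1) * ‖ζ (j + 1)‖ ^ 2
        ≤ 2 * 2 ^ (j + 1) * (‖f 1‖ * (1 / 2 : ℝ) ^ (j + 1)) ^ 2 := by gcongr
      _ = ‖f 1‖ ^ 2 * (1 / 2) ^ j * ((2 * (1 / 2)) ^ (j + 1)) := by rw [mul_pow, mul_pow]; ring
      _ ≤ _ := by
        rw [show (2 * (1 / 2) : ℝ) = 1 by norm_num, one_pow, mul_one, mul_right_comm]
        exact le_mul_of_one_le_right (by positivity) one_le_two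
  obtain ⟨ξ, hξ⟩ := exists_norm_sq_amplify_eq_tsum _ hs
  refine ⟨ξ, fun A => le_of_sq_le_sq ?_ (norm_nonneg _)⟩
  have hA : ∀ j, ‖amplify (A : H →L[ℂ] H) (((√(2 ^ (j + 1)) : ℝ) : ℂ) • ζ j)‖ ^ 2
      = 2 * (2 ^ j * ‖f A (v j)‖ ^ 2) := fun j => by
    rw [map_smul, norm_smul, mul_pow, hpow, hζ, mul_assoc]
  have hsA : Summable fun j =>
      ‖amplify (A : H →L[ℂ] H) (((√(2 ^ (j + 1)) : ℝ) : ℂ) • ζ j)‖ ^ 2 := by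
    refine Summable.of_nonneg_of_le (fun j => by positivity) (fun j => ?_)
      (hs.mul_left (‖amplify (A : H →L[ℂ] H)‖ ^ 2))
    rw [← mul_pow]
    exact pow_le_pow_left₀ (norm_nonneg _) (ContinuousLinearMap.le_opNorm _ _) 2
  rw [hξ]
  refine le_of_tendsto ((((f A).continuous.tendsto k).comp hv).norm.pow 2)
    (Filter.Eventually.of_forall fun n => ?_)
  rw [Function.comp_apply, map_sum]
  calc _ ≤ (∑ j ∈ Finset.range (n + 1), ‖f A (v j)‖) ^ 2 :=
        pow_le_pow_left₀ (norm_nonneg _) (norm_sum_le _ _) 2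
    _ ≤ _ := sq_sum_range_le _ _
    _ = ∑ j ∈ Finset.range (n + 1),
        ‖amplify (A : H →L[ℂ] H) (((√(2 ^ (j + 1)) : ℝ) : ℂ) • ζ j)‖ ^ 2 := by
      rw [Finset.mul_sum]; exact Finset.sum_congr rfl fun j _ => (hA j).symm
    _ ≤ _ := hsA.sum_le_tsum _ fun j _ => by positivity

/-- A `*`-representation is normal if all vectors are dominated. -/
theorem isNormal_of_dominated (f : M →⋆ₙₐ[ℂ] (K →L[ℂ] K)) (h : ∀ k, k ∈ dominated f) :
    IsNormal M f := by
  refine continuous_iInf_rng.2 ?_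
  rintro ⟨⟨ξ, η⟩, hξ, hη⟩
  refine continuous_induced_rng.2 ?_
  choose ζ hζ using fun m => exists_norm_amplify_eq (h (ξ m))
  have hs : Summable fun m => ‖ζ m‖ ^ 2 := by
    refine Summable.of_nonneg_of_le (fun j => by positivity) (fun m => ?_)
      (hξ.mul_left (‖f 1‖ ^ 2))
    rw [← mul_pow]
    refine pow_le_pow_left₀ (norm_nonneg _) ?_ 2
    rw [← amplify_one (ζ m)]
    exact (hζ m 1).trans_le ((f 1).le_opNorm _)
  obtain ⟨z, hz⟩ := exists_norm_sq_amplify_eq_tsum ζ hs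
  -- Since `X (A ⊗ 1)z = (f(A) ⊗ 1)ξ`, the functional `∑ ⟨ηₙ, f(A)ξₙ⟩` equals `⟨X⋆η, (A ⊗ 1)z⟩`, a
  -- defining functional of the σ-weak topology on `B(H)`.
  obtain ⟨X, hX, -⟩ := exists_intertwiner (amplifyRep M) (amplifyHom.comp f) z (Ampl.mk ξ hξ)
    (fun A => le_of_sq_le_sq (by
      change ‖amplify (f A) _‖ ^ 2 ≤ ‖amplify (A : H →L[ℂ] H) z‖ ^ 2
      rw [hz, norm_sq_amplify]
      exact le_of_eq (tsum_congr fun m => by rw [hζ]; rfl)) (norm_nonneg _))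
  have hc := continuous_sigmaWeak_tsum z (ContinuousLinearMap.adjoint X (Ampl.mk η hη))
  have hc' := @Continuous.comp M (H →L[ℂ] H) ℂ (TopologicalSpace.induced Subtype.val (sigmaWeak H))
    (sigmaWeak H) _ _ _ hc continuous_induced_dom
  convert hc' using 1
  funext A
  have e1 : inner ℂ (ContinuousLinearMap.adjoint X (Ampl.mk η hη)) (amplify (A : H →L[ℂ] H) z)
      = inner ℂ (Ampl.mk η hη) (amplify (f A) (Ampl.mk ξ hξ)) := by
    rw [ContinuousLinearMap.adjoint_inner_left]
    exact congrArg (inner ℂ (Ampl.mk η hη)) (hX A)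
  rw [lp.inner_eq_tsum, lp.inner_eq_tsum] at e1
  exact e1.symm

/-- A dominated vector belongs to the closed span of the ranges of the operators that intertwine
the identity representation with `f`. -/
theorem map_one_mem_of_dominated {f : M →⋆ₙₐ[ℂ] (K →L[ℂ] K)} {k : K} (hk : k ∈ dominated f)
    {L : Submodule ℂ K} (hL : IsClosed (L : Set K))
    (h : ∀ X : H →L[ℂ] K, (∀ A : M, X ∘L (A : H →L[ℂ] H) = f A ∘L X) → ∀ x, X x ∈ L) :
    f 1 k ∈ L := by
  classical
  obtain ⟨ζ, hζ⟩ := hk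
  obtain ⟨X, hX, hXi⟩ := exists_intertwiner (amplifyRep M) f ζ k hζ
  have e : f 1 k = X ζ := (hX 1).symm
  rw [e]
  -- `X ζ` is the sum of the images of the coordinates of `ζ`, and `X` restricted to each coordinate
  -- copy of `H` is an intertwiner.
  have hs := (lp.hasSum_single (p := 2) (by norm_num) ζ).mapL X
  refine hL.mem_of_tendsto hs (Filter.Eventually.of_forall fun s => L.sum_mem fun n _ => ?_)
  refine h (X ∘L lp.singleContinuousLinearMap ℂ (fun _ : ℕ => H) 2 n) (fun A => ?_) (ζ n)
  ext x
  have := DFunLike.congr_fun (hXi A) (lp.single 2 n x)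
  simp only [ContinuousLinearMap.comp_apply] at this ⊢
  refine Eq.trans ?_ this
  change X (lp.single 2 n ((A : H →L[ℂ] H) x)) = X (amplify (A : H →L[ℂ] H) (lp.single 2 n x))
  congr 1
  ext m
  rcases eq_or_ne m n with rfl | hmn
  · simp
  · simp [lp.single_apply, hmn]

/-- For a `*`-representation `⟨k, f(A⋆A)k⟩ = ‖f(A)k‖²`, so `IsNormal.exists_le` is already
domination. -/
theorem IsNormal.dominated_eq_top {f : M →⋆ₙₐ[ℂ] (K →L[ℂ] K)} (hf : IsNormal M f) (k : K) :
    k ∈ dominated f := by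
  obtain ⟨ζ, hζ⟩ := IsNormal.exists_le
    (f := { toFun := f, map_add' := map_add f, map_smul' := map_smul f }) hf k
  refine ⟨ζ, fun A => le_of_sq_le_sq (le_trans ?_ (hζ A)) (norm_nonneg _)⟩
  change _ ≤ ‖inner ℂ k (f (star A * A) k)‖
  rw [map_mul, map_star, mul_apply_eq_comp, ContinuousLinearMap.star_eq_adjoint,
    ContinuousLinearMap.adjoint_inner_right, inner_self_eq_norm_sq_to_K]
  simp

end Normal

/-! ### Elementary tensors in interior tensor products -/

section PosForm

variable {A : Type v} [AddCommGroup A] [Module ℂ A]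
variable {H : Type u} [NormedAddCommGroup H] [InnerProductSpace ℂ H] [CompleteSpace H]

namespace PosForm

variable (κ : PosForm A H)

/-- `h ↦ a ⊗ h` as a bounded operator. -/
def tmulL (a : A) : H →L[ℂ] κ.Space :=
  LinearMap.mkContinuousOfExistsBound
    { toFun := κ.tmul a
      map_add' := fun h k => by simp [tmul, UniformSpace.Completion.coe_add]
      map_smul' := fun c h => by simp [tmul, UniformSpace.Completion.coe_smul] }
    ⟨√‖κ.form a a‖, fun h => by
      refine le_of_sq_le_sq ?_ (by positivity)
      rw [mul_pow, Real.sq_sqrt (norm_nonneg _), ← inner_self_eq_norm_sq (𝕜 := ℂ)]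
      change RCLike.re (inner ℂ (κ.tmul a h) (κ.tmul a h)) ≤ _
      rw [inner_tmul]
      calc _ ≤ ‖inner ℂ h (κ.form a a h)‖ := RCLike.re_le_norm _
        _ ≤ ‖h‖ * (‖κ.form a a‖ * ‖h‖) :=
          (norm_inner_le_norm _ _).trans (by gcongr; exact ContinuousLinearMap.le_opNorm _ _)
        _ = _ := by ring⟩

@[simp] theorem tmulL_apply (a : A) (h : H) : κ.tmulL a h = κ.tmul a h := rfl

theorem mem_of_tmul_mem {L : Submodule ℂ κ.Space} (hL : IsClosed (L : Set κ.Space))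
    (h : ∀ a x, κ.tmul a x ∈ L) (z : κ.Space) : z ∈ L := by
  induction z using UniformSpace.Completion.induction_on with
  | hp => exact hL
  | ih x =>
    induction x using κ.pre_induction with
    | h0 => rw [UniformSpace.Completion.coe_zero]; exact L.zero_mem
    | h1 a x => exact h a x
    | h2 x y hx hy => rw [UniformSpace.Completion.coe_add]; exact L.add_mem hx hy

theorem ext_inner_tmul {x y : κ.Space}
    (h : ∀ a k, inner ℂ (κ.tmul a k) x = inner ℂ (κ.tmul a k) y) : x = y := by
  refine ext_inner_right ℂ fun z => ?_
  have e : innerSL ℂ x = innerSL ℂ y := κ.hom_ext fun a k => by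
    rw [innerSL_apply_apply, innerSL_apply_apply, ← inner_conj_symm, h, inner_conj_symm]
  exact DFunLike.congr_fun e z

end PosForm

end PosForm

/-! ### The Arveson correspondence as a space of intertwiners -/

section Stinespring

variable {H : Type u} [NormedAddCommGroup H] [InnerProductSpace ℂ H] [CompleteSpace H]
variable {M : VonNeumannAlgebra H} (P : M →CP M)

theorem stinespringRep_add (S T : M) :
    stinespringRep P (S + T) = stinespringRep P S + stinespringRep P T :=
  PosForm.hom_ext _ fun R h => by
    rw [add_apply, stinespringRep_tmul, stinespringRep_tmul, stinespringRep_tmul, add_mul]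
    simp [PosForm.tmul, UniformSpace.Completion.coe_add]

theorem stinespringRep_smul (c : ℂ) (T : M) :
    stinespringRep P (c • T) = c • stinespringRep P T :=
  PosForm.hom_ext _ fun R h => by
    rw [smul_apply, stinespringRep_tmul, stinespringRep_tmul, smul_mul_assoc]
    simp [PosForm.tmul, UniformSpace.Completion.coe_smul]

theorem stinespringRep_mul (S T : M) :
    stinespringRep P (S * T) = stinespringRep P S * stinespringRep P T :=
  PosForm.hom_ext _ fun R h => by
    rw [mul_apply_eq_comp, stinespringRep_tmul, stinespringRep_tmul, stinespringRep_tmul, mul_assoc]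

theorem stinespringRep_one : stinespringRep P 1 = 1 :=
  PosForm.hom_ext _ fun R h => by rw [stinespringRep_tmul, one_mul]; rfl

/-- The Stinespring representation as a `*`-homomorphism. -/
def stinespringHom : M →⋆ₙₐ[ℂ] (Stinespring P →L[ℂ] Stinespring P) where
  toFun := stinespringRep P
  map_smul' := stinespringRep_smul P
  map_zero' := by
    have := stinespringRep_smul P 0 0
    simpa using this
  map_add' := stinespringRep_add P
  map_mul' := stinespringRep_mul P
  map_star' T := (adjoint_stinespringRep P T).symm

theorem adjoint_phi_intertwines (Y : arveson P) (T : M) (h : H) :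
    stinespringRep P T (ContinuousLinearMap.adjoint (phi P Y) h)
      = ContinuousLinearMap.adjoint (phi P Y) ((T : H →L[ℂ] H) h) := by
  have h2 := congrArg ContinuousLinearMap.adjoint (phi_stinespringRep P Y (star T))
  rw [ContinuousLinearMap.adjoint_comp, ContinuousLinearMap.adjoint_comp,
    adjoint_stinespringRep, star_star] at h2
  have h3 : ContinuousLinearMap.adjoint ((star T : M) : H →L[ℂ] H) = T := star_star (T : H →L[ℂ] H)
  rw [h3] at h2
  exact DFunLike.congr_fun h2 h

/-- Every intertwiner of the identity representation and the Stinespring representation is the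
adjoint of `Φ_Y` for some `Y` in the Arveson correspondence. -/
theorem exists_phi_eq_adjoint (X : H →L[ℂ] Stinespring P)
    (hX : ∀ T : M, X ∘L (T : H →L[ℂ] H) = stinespringRep P T ∘L X) :
    ∃ Y : arveson P, phi P Y = ContinuousLinearMap.adjoint X := by
  -- Forced by `Φ_Y(1 ⊗ h) = Y⋆h`.
  let Y : H →L[ℂ] H := star (ContinuousLinearMap.adjoint X ∘L (cpForm P).tmulL 1)
  have hX' : ∀ T : M, ContinuousLinearMap.adjoint X ∘L stinespringRep P T
      = (T : H →L[ℂ] H) ∘L ContinuousLinearMap.adjoint X := by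
    intro T
    have h2 := congrArg ContinuousLinearMap.adjoint (hX (star T))
    rw [ContinuousLinearMap.adjoint_comp, ContinuousLinearMap.adjoint_comp,
      adjoint_stinespringRep, star_star] at h2
    rw [← h2]
    congr 1
    exact star_star (T : H →L[ℂ] H)
  have hY : ∀ (S : M) (h : H), (S : H →L[ℂ] H) (star Y h)
      = ContinuousLinearMap.adjoint X ((cpForm P).tmul S h) := by
    intro S h
    have h1 := DFunLike.congr_fun (hX' S) ((cpForm P).tmul 1 h)
    rw [ContinuousLinearMap.comp_apply, ContinuousLinearMap.comp_apply, stinespringRep_tmul,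
      mul_one] at h1
    rw [h1, star_star]
    rfl
  have hmem : Y ∈ arveson P := by
    have e : prePhi P Y = (ContinuousLinearMap.adjoint X).toLinearMap ∘ₗ
        (UniformSpace.Completion.toComplL (𝕜 := ℂ) (E := (cpForm P).Pre)).toLinearMap :=
      PosForm.pre_hom_ext _ fun S h => hY S h
    change Continuous (prePhi P Y)
    rw [e]
    exact (ContinuousLinearMap.adjoint X).continuous.comp (ContinuousLinearMap.continuous _)
  exact ⟨⟨Y, hmem⟩, PosForm.hom_ext _ fun S h => by rw [phi_tmul]; exact hY S h⟩

variable {P}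

/-- `‖π_P(A)(S ⊗ h)‖² = ⟨h, P((AS)⋆AS)h⟩`, which normality of `P` bounds by `‖(AS ⊗ 1)ζ‖²`; so `(S ⊗
1)ζ` dominates. Every later use of the normality of `P` goes through this bound. -/
theorem tmul_mem_dominated (hP : IsNormal M (fun A : M => (P A : H →L[ℂ] H))) (S : M) (h : H) :
    (cpForm P).tmul S h ∈ dominated (stinespringHom P) := by
  obtain ⟨ζ, hζ⟩ := IsNormal.exists_le (K := H)
    (f := { toFun := fun A : M => (P A : H →L[ℂ] H),
            map_add' := by intros; simp, map_smul' := by intros; simp }) hP h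
  refine ⟨amplify (S : H →L[ℂ] H) ζ, fun A => le_of_sq_le_sq ?_ (norm_nonneg _)⟩
  refine le_trans ?_ (hζ (A * S))
  change ‖stinespringRep P A ((cpForm P).tmul S h)‖ ^ 2
    ≤ ‖inner ℂ h ((P (star (A * S) * (A * S)) : H →L[ℂ] H) h)‖
  rw [stinespringRep_tmul, ← inner_self_eq_norm_sq (𝕜 := ℂ), PosForm.inner_tmul, cpForm_apply]
  exact RCLike.re_le_norm _

/-- For normal `P`, the vectors `Φ_Y⋆ h` span a dense subspace of `M ⊗_P H`. -/
theorem mem_of_adjoint_phi_mem (hP : IsNormal M (fun A : M => (P A : H →L[ℂ] H)))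
    {L : Submodule ℂ (Stinespring P)} (hL : IsClosed (L : Set (Stinespring P)))
    (h : ∀ Y x, ContinuousLinearMap.adjoint (phi P Y) x ∈ L) (z : Stinespring P) : z ∈ L := by
  refine (cpForm P).mem_of_tmul_mem hL (fun S k => ?_) z
  have h1 := map_one_mem_of_dominated (tmul_mem_dominated hP S k) hL fun X hX x => by
    obtain ⟨Y, hY⟩ := exists_phi_eq_adjoint P X hX
    have := h Y x
    rwa [hY, ContinuousLinearMap.adjoint_adjoint] at this
  have h2 : stinespringHom P 1 = 1 := stinespringRep_one P
  rwa [h2] at h1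

theorem arvesonInner_apply (Y Z : arveson P) (h : H) :
    (arvesonInner P Y Z : H →L[ℂ] H) h = phi P Y (ContinuousLinearMap.adjoint (phi P Z) h) := rfl

theorem phi_add (Y Z : arveson P) : phi P (Y + Z) = phi P Y + phi P Z :=
  PosForm.hom_ext _ fun S h => by simp [phi_tmul]

/-- `Φ_Y` involves `Y⋆`, hence the conjugate; the adjoints `Φ_Y⋆` depend linearly on `Y`. -/
theorem phi_smul (c : ℂ) (Y : arveson P) : phi P (c • Y) = (starRingEnd ℂ c) • phi P Y :=
  PosForm.hom_ext _ fun S h => by simp [phi_tmul]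

theorem adjoint_phi_add (Y Z : arveson P) :
    ContinuousLinearMap.adjoint (phi P (Y + Z))
      = ContinuousLinearMap.adjoint (phi P Y) + ContinuousLinearMap.adjoint (phi P Z) := by
  rw [phi_add, map_add]

theorem adjoint_phi_smul (c : ℂ) (Y : arveson P) :
    ContinuousLinearMap.adjoint (phi P (c • Y)) = c • ContinuousLinearMap.adjoint (phi P Y) := by
  rw [phi_smul, map_smulₛₗ, starRingEnd_self_apply]

end Stinespring

/-! ### The corner `M` of `R`, and the commutant of `R` -/

section Corner

variable {H : Type u} [NormedAddCommGroup H] [InnerProductSpace ℂ H] [CompleteSpace H]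
variable {M : VonNeumannAlgebra H} {P : M →CP M}
variable {K : Type v} [NormedAddCommGroup K] [InnerProductSpace ℂ K] [CompleteSpace K]

namespace MinimalIsometricDilation

variable (D : MinimalIsometricDilation P (identityT P) (identityσ M) K)

theorem adjoint_W_W (h : H) : ContinuousLinearMap.adjoint D.W (D.W h) = h :=
  DFunLike.congr_fun ((ContinuousLinearMap.norm_map_iff_adjoint_comp_self D.W).1 D.isometry_W) h

theorem ρ_W (S : M.commutant) (h : H) : D.ρ S (D.W h) = D.W ((S : H →L[ℂ] H) h) :=
  DFunLike.congr_fun (D.restrict S) h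

theorem adjoint_W_ρ (S : M.commutant) (k : K) :
    ContinuousLinearMap.adjoint D.W (D.ρ S k)
      = (S : H →L[ℂ] H) (ContinuousLinearMap.adjoint D.W k) := by
  refine ext_inner_left ℂ fun h => ?_
  have e : D.ρ S = ContinuousLinearMap.adjoint (D.ρ (star S)) := by
    rw [← ContinuousLinearMap.star_eq_adjoint, ← map_star, star_star]
  rw [ContinuousLinearMap.adjoint_inner_right, e, ContinuousLinearMap.adjoint_inner_right, ρ_W,
    ← ContinuousLinearMap.adjoint_inner_right, ← ContinuousLinearMap.adjoint_inner_right]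
  congr 1
  change ContinuousLinearMap.adjoint (ContinuousLinearMap.adjoint (S : H →L[ℂ] H)) _ = _
  rw [ContinuousLinearMap.adjoint_adjoint]

/-- Invariance puts `V(Y)⋆Wh` in `WH`, and the adjoint of the compression identity tells which
vector it is. -/
theorem star_V_W (Y : arveson P) (h : H) :
    star (D.V Y) (D.W h) = D.W (star (Y : H →L[ℂ] H) h) := by
  obtain ⟨g, hg⟩ := D.invariant Y h
  change D.W g = _ at hg
  rw [← hg]
  congr 1
  rw [← D.adjoint_W_W g, hg]
  have h1 := congrArg ContinuousLinearMap.adjoint (D.compress Y)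
  rw [ContinuousLinearMap.adjoint_comp, ContinuousLinearMap.adjoint_comp,
    ContinuousLinearMap.adjoint_adjoint] at h1
  exact DFunLike.congr_fun h1 h

/-- Unitality of `ρ` is not assumed; it follows from minimality, because the fixed space of `ρ(1)`
reduces `(V, ρ)` and contains `WH`. -/
theorem ρ_one : D.ρ 1 = 1 := by
  have hidem : ∀ k, D.ρ 1 (D.ρ 1 k) = D.ρ 1 k := fun k => by
    rw [← mul_apply_eq_comp, ← map_mul, one_mul]
  let L : Submodule ℂ K := LinearMap.eqLocus (D.ρ 1).toLinearMap LinearMap.id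
  have hL : L = ⊤ := by
    refine D.minimal L (isClosed_eq (D.ρ 1).continuous continuous_id) (fun h => ?_)
      ⟨fun Y k _ => ?_, fun Y k _ => ?_, fun S k _ => ?_⟩
    · exact D.ρ_W 1 h
    · change D.ρ 1 (D.V Y k) = D.V Y k
      rw [← mul_apply_eq_comp, ← D.map_lact]
      congr 2
    · change D.ρ 1 (star (D.V Y) k) = star (D.V Y) k
      rw [← mul_apply_eq_comp]
      have h1 : D.V Y * D.ρ 1 = D.V Y := by
        rw [← D.map_ract]
        congr 1
      have h2 := congrArg star h1
      rw [star_mul, ← map_star, star_one] at h2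
      rw [h2]
    · change D.ρ 1 (D.ρ S k) = D.ρ S k
      rw [← mul_apply_eq_comp, ← map_mul, one_mul]
  ext k
  have : k ∈ L := hL ▸ Submodule.mem_top
  exact this

theorem compress_mem {S : K →L[ℂ] K} (hS : S ∈ D.algebra) :
    ContinuousLinearMap.adjoint D.W ∘L S ∘L D.W ∈ M := by
  refine mem_of_commute M fun B hB => ?_
  have h := D.mem_algebra.1 hS ⟨B, hB⟩
  ext x
  change B (ContinuousLinearMap.adjoint D.W (S (D.W x)))
    = ContinuousLinearMap.adjoint D.W (S (D.W (B x)))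
  rw [← D.adjoint_W_ρ ⟨B, hB⟩, ← D.ρ_W ⟨B, hB⟩]
  congr 1
  exact DFunLike.congr_fun h (D.W x)

theorem dilate_mem {A : H →L[ℂ] H} (hA : A ∈ M) :
    D.W ∘L A ∘L ContinuousLinearMap.adjoint D.W ∈ D.algebra := by
  rw [D.mem_algebra]
  intro S
  ext k
  change D.ρ S (D.W (A (ContinuousLinearMap.adjoint D.W k)))
    = D.W (A (ContinuousLinearMap.adjoint D.W (D.ρ S k)))
  rw [D.ρ_W, D.adjoint_W_ρ]
  congr 1
  exact (DFunLike.congr_fun (mul_comm_of_mem hA S.2) _).symm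

theorem compress_dilate (A : H →L[ℂ] H) : ContinuousLinearMap.adjoint D.W ∘L
    (D.W ∘L A ∘L ContinuousLinearMap.adjoint D.W) ∘L D.W = A := by
  ext h
  simp [D.adjoint_W_W]

theorem proj_mem : D.W ∘L ContinuousLinearMap.adjoint D.W ∈ D.algebra := by
  have := D.dilate_mem (one_mem M)
  exact this

theorem compress_image : (fun S : K →L[ℂ] K => ContinuousLinearMap.adjoint D.W ∘L S ∘L D.W) ''
    (D.algebra : Set (K →L[ℂ] K)) = (M : Set (H →L[ℂ] H)) := by
  ext A
  constructor
  · rintro ⟨S, hS, rfl⟩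
    exact D.compress_mem hS
  · intro hA
    exact ⟨_, D.dilate_mem hA, D.compress_dilate A⟩

theorem corner_eq : (fun A : H →L[ℂ] H => D.W ∘L A ∘L ContinuousLinearMap.adjoint D.W) ''
      (M : Set (H →L[ℂ] H)) =
    (fun S : K →L[ℂ] K => (D.W ∘L ContinuousLinearMap.adjoint D.W) * S *
      (D.W ∘L ContinuousLinearMap.adjoint D.W)) '' (D.algebra : Set (K →L[ℂ] K)) := by
  rw [← D.compress_image, Set.image_image]
  rfl

/-- The operators that intertwine the identity representation with `ρ` have jointly total range. -/
theorem mem_of_intertwiner_mem {L : Submodule ℂ K} (hL : IsClosed (L : Set K))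
    (h : ∀ X : H →L[ℂ] K, (∀ B : M.commutant, X ∘L (B : H →L[ℂ] H) = D.ρ B ∘L X) → ∀ x, X x ∈ L)
    (k : K) : k ∈ L := by
  have := map_one_mem_of_dominated (D.normal.dominated_eq_top k) hL h
  rwa [D.ρ_one] at this

/-- For `X` in `R'`, the candidate is `ρ(B)` with `B = W⋆XW`. Agreement on `WH` holds because `X`
commutes with `WW⋆`; it spreads to `K` along the operators `ZW⋆` of `R`, with `Z` an intertwiner,
since these commute with both `X` and `ρ(B)`. -/
theorem commutant_eq_range : (D.algebra.commutant : Set (K →L[ℂ] K)) = Set.range D.ρ := by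
  ext X
  constructor
  · intro hX
    have hX' : ∀ S ∈ D.algebra, ∀ k, S (X k) = X (S k) := fun S hS k =>
      DFunLike.congr_fun (VonNeumannAlgebra.mem_commutant_iff.1 hX S hS) k
    have hB : ContinuousLinearMap.adjoint D.W ∘L X ∘L D.W ∈ M.commutant := by
      rw [VonNeumannAlgebra.mem_commutant_iff]
      intro A hA
      ext h
      have h1 := hX' _ (D.dilate_mem hA) (D.W h)
      have h2 := congrArg (ContinuousLinearMap.adjoint D.W) h1
      simpa [D.adjoint_W_W] using h2
    refine ⟨⟨_, hB⟩, ?_⟩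
    have hW : ∀ h, D.ρ ⟨_, hB⟩ (D.W h) = X (D.W h) := by
      intro h
      rw [D.ρ_W]
      have h1 := hX' _ D.proj_mem (D.W h)
      simpa [D.adjoint_W_W] using h1
    let L : Submodule ℂ K := LinearMap.eqLocus (D.ρ ⟨_, hB⟩).toLinearMap X.toLinearMap
    ext k
    refine D.mem_of_intertwiner_mem (L := L)
      (isClosed_eq (ContinuousLinearMap.continuous _) X.continuous) (fun Z hZ x => ?_) k
    have hmem : Z ∘L ContinuousLinearMap.adjoint D.W ∈ D.algebra := by
      rw [D.mem_algebra]
      intro S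
      ext k
      change D.ρ S (Z (ContinuousLinearMap.adjoint D.W k))
        = Z (ContinuousLinearMap.adjoint D.W (D.ρ S k))
      rw [D.adjoint_W_ρ]
      exact (DFunLike.congr_fun (hZ S) _).symm
    change D.ρ ⟨_, hB⟩ (Z x) = X (Z x)
    have e : Z x = (Z ∘L ContinuousLinearMap.adjoint D.W) (D.W x) := by
      rw [ContinuousLinearMap.comp_apply, D.adjoint_W_W]
    rw [e, ← hX' _ hmem, ← hW]
    exact DFunLike.congr_fun (D.mem_algebra.1 hmem _) (D.W x)
  · rintro ⟨S, rfl⟩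
    rw [SetLike.mem_coe, VonNeumannAlgebra.mem_commutant_iff]
    exact fun T hT => (D.mem_algebra.1 hT S).symm

end MinimalIsometricDilation

end Corner

/-! ### The induced endomorphism -/

section Endomorphism

variable {H : Type u} [NormedAddCommGroup H] [InnerProductSpace ℂ H] [CompleteSpace H]
variable {M : VonNeumannAlgebra H} {P : M →CP M}
variable {K : Type v} [NormedAddCommGroup K] [InnerProductSpace ℂ K] [CompleteSpace K]

namespace IsometricRep

variable (D : IsometricRep P K)

theorem idTensor_tmul (S : D.algebra) (Y : arveson P) (k : K) :
    D.idTensor S (D.repForm.tmul Y k) = D.repForm.tmul Y ((S : K →L[ℂ] K) k) :=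
  PosForm.right_tmul _ _ _ _ _ _

theorem adjoint_tilde_tilde (x : D.Tensor) : ContinuousLinearMap.adjoint D.tilde (D.tilde x) = x :=
  DFunLike.congr_fun D.adjoint_tilde_comp_tilde x

/-- The relation `Θ_V(S)V(Y) = V(Y)S`, a consequence of `Ṽ⋆Ṽ = 1`, from which normality of `Θ_V` is
read off. -/
theorem inducedAux_V (S : D.algebra) (Y : arveson P) (k : K) :
    D.inducedAux S (D.V Y k) = D.V Y ((S : K →L[ℂ] K) k) := by
  have := DFunLike.congr_fun (D.inducedAux_comp_tilde S) (D.repForm.tmul Y k)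
  rwa [ContinuousLinearMap.comp_apply, ContinuousLinearMap.comp_apply, idTensor_tmul, tilde_tmul,
    tilde_tmul] at this

theorem idTensor_star (S : D.algebra) :
    D.idTensor (star S) = ContinuousLinearMap.adjoint (D.idTensor S) := by
  refine PosForm.hom_ext _ fun Y k => PosForm.ext_inner_tmul _ fun Z l => ?_
  rw [ContinuousLinearMap.adjoint_inner_right, idTensor_tmul, idTensor_tmul, PosForm.inner_tmul,
    PosForm.inner_tmul]
  have h := mul_comm_of_mem (star_mem S.2) (D.repForm_mem Z Y)
  have h1 := DFunLike.congr_fun h k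
  rw [mul_apply_eq_comp, mul_apply_eq_comp] at h1
  rw [← ContinuousLinearMap.adjoint_inner_right, ← ContinuousLinearMap.star_eq_adjoint, h1]
  rfl

/-- The induced map as a `*`-homomorphism into `B(K)`. -/
def inducedHom : D.algebra →⋆ₙₐ[ℂ] (K →L[ℂ] K) where
  toFun := D.inducedAux
  map_smul' c S := by
    have : D.idTensor (c • S) = c • D.idTensor S := PosForm.hom_ext _ fun Y k => by
      rw [smul_apply, idTensor_tmul, idTensor_tmul]
      exact map_smul (D.repForm.tmulL Y) c _
    simp only [inducedAux, this, ContinuousLinearMap.smul_comp, ContinuousLinearMap.comp_smul]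
    rfl
  map_zero' := by
    have : D.idTensor 0 = 0 := PosForm.hom_ext _ fun Y k => by
      rw [idTensor_tmul]
      exact map_zero (D.repForm.tmulL Y)
    rw [inducedAux, this]
    simp
  map_add' S T := by
    have : D.idTensor (S + T) = D.idTensor S + D.idTensor T := PosForm.hom_ext _ fun Y k => by
      rw [add_apply, idTensor_tmul, idTensor_tmul, idTensor_tmul]
      exact map_add (D.repForm.tmulL Y) _ _
    simp only [inducedAux, this, ContinuousLinearMap.add_comp, ContinuousLinearMap.comp_add]
  map_mul' S T := by
    have : D.idTensor (S * T) = D.idTensor S ∘L D.idTensor T := PosForm.hom_ext _ fun Y k => by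
      rw [ContinuousLinearMap.comp_apply, idTensor_tmul, idTensor_tmul, idTensor_tmul]
      rfl
    ext k
    simp only [inducedAux, this, ContinuousLinearMap.comp_apply, mul_apply_eq_comp,
      adjoint_tilde_tilde]
  map_star' S := by
    rw [ContinuousLinearMap.star_eq_adjoint, inducedAux, inducedAux, idTensor_star,
      ContinuousLinearMap.adjoint_comp, ContinuousLinearMap.adjoint_comp,
      ContinuousLinearMap.adjoint_adjoint]
    rfl

end IsometricRep

namespace MinimalIsometricDilation

variable (D : MinimalIsometricDilation P (identityT P) (identityσ M) K)

/-- The vectors `V(Y₁) ⋯ V(Yₙ) W h`. -/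
inductive IsWord : K → Prop
  | base (h : H) : IsWord (D.W h)
  | step (Y : arveson P) {k : K} (hk : IsWord k) : IsWord (D.V Y k)

theorem IsWord.ρ_apply {k : K} (hk : D.IsWord k) (S : M.commutant) : D.IsWord (D.ρ S k) := by
  cases hk with
  | base h => rw [D.ρ_W]; exact .base _
  | step Y hk =>
    rw [← mul_apply_eq_comp, ← D.map_lact]
    exact .step _ hk

/-- `V(Z)⋆` cancels the leading letter up to `ρ(⟨Z, Y⟩)`, which the next letter, or `W`, absorbs. -/
theorem IsWord.star_V_apply {k : K} (hk : D.IsWord k) (Z : arveson P) :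
    D.IsWord (star (D.V Z) k) := by
  cases hk with
  | base h => rw [D.star_V_W]; exact .base _
  | step Y hk =>
    rw [← mul_apply_eq_comp, D.isometric]
    exact hk.ρ_apply D _

/-- The closed span of the words reduces `(V, ρ)`, so by minimality the words are total. -/
theorem mem_of_isWord_mem {L : Submodule ℂ K} (hL : IsClosed (L : Set K))
    (h : ∀ k, D.IsWord k → k ∈ L) (k : K) : k ∈ L := by
  let L' : Submodule ℂ K := (Submodule.span ℂ {k | D.IsWord k}).topologicalClosure
  have hw : ∀ k, D.IsWord k → k ∈ L' := fun k hk =>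
    Submodule.le_topologicalClosure _ (Submodule.subset_span hk)
  have hcl : IsClosed (L' : Set K) := Submodule.isClosed_topologicalClosure _
  have hinv : ∀ T : K →L[ℂ] K, (∀ k, D.IsWord k → D.IsWord (T k)) → ∀ k ∈ L', T k ∈ L' := by
    intro T hT k hk
    have : L' ≤ L'.comap (T : K →ₗ[ℂ] K) :=
      Submodule.topologicalClosure_minimal _ (Submodule.span_le.2 fun x hx => hw _ (hT x hx))
        (hcl.preimage T.continuous)
    exact this hk
  have htop : L' = ⊤ := D.minimal L' hcl (fun x => hw _ (.base x))
    ⟨fun Y => hinv _ fun k hk => .step Y hk, fun Y => hinv _ fun k hk => hk.star_V_apply D Y,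
      fun S => hinv _ fun k hk => hk.ρ_apply D S⟩
  have hle : L' ≤ L := Submodule.topologicalClosure_minimal _ (Submodule.span_le.2 h) hL
  exact hle (htop ▸ Submodule.mem_top)

/-- `Y ⊗ k ↦ Φ_Y⋆ W⋆ k` on the algebraic tensor product. -/
def preToStinespring : D.repForm.Pre →ₗ[ℂ] Stinespring P :=
  D.repForm.lift (LinearMap.mk₂ ℂ
    (fun Y k => ContinuousLinearMap.adjoint (phi P Y) (ContinuousLinearMap.adjoint D.W k))
    (fun Y Z k => by rw [adjoint_phi_add, add_apply])
    (fun c Y k => by rw [adjoint_phi_smul, smul_apply])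
    (fun Y k l => by rw [map_add, map_add]) (fun c Y k => by rw [map_smul, map_smul]))

theorem preToStinespring_pure (Y : arveson P) (k : K) :
    D.preToStinespring (D.repForm.pure Y k)
      = ContinuousLinearMap.adjoint (phi P Y) (ContinuousLinearMap.adjoint D.W k) := rfl

theorem inner_adjoint_phi (Y Z : arveson P) (h k : H) :
    inner ℂ (ContinuousLinearMap.adjoint (phi P Y) h) (ContinuousLinearMap.adjoint (phi P Z) k)
      = inner ℂ h ((arvesonInner P Y Z : H →L[ℂ] H) k) := by
  rw [ContinuousLinearMap.adjoint_inner_left, arvesonInner_apply]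

/-- Because `ρ(B)W = WB`, the inner product pulled back from `M ⊗_P H` is `⟨x, (I ⊗ WW⋆)y⟩`. -/
theorem norm_preToStinespring_le (x : D.repForm.Pre) :
    ‖D.preToStinespring x‖ ≤ √‖D.W ∘L ContinuousLinearMap.adjoint D.W‖ * ‖x‖ := by
  have main : ∀ x y, inner ℂ (D.preToStinespring x) (D.preToStinespring y)
      = D.repForm.gram x (D.repForm.preRight (D.W ∘L ContinuousLinearMap.adjoint D.W) y) := by
    intro x y
    induction x using PosForm.pre_induction with
    | h0 => simp
    | h2 x x' hx hx' => simp only [map_add, LinearMap.add_apply, inner_add_left, hx, hx']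
    | h1 a h =>
      induction y using PosForm.pre_induction with
      | h0 => simp
      | h2 y y' hy hy' => simp only [map_add, inner_add_right, hy, hy']
      | h1 b k =>
        rw [preToStinespring_pure, preToStinespring_pure, inner_adjoint_phi,
          PosForm.preRight_pure, PosForm.gram_pure, IsometricRep.repForm_apply,
          ContinuousLinearMap.comp_apply, D.ρ_W, ContinuousLinearMap.adjoint_inner_left]
  refine le_of_sq_le_sq ?_ (by positivity)
  rw [mul_pow, Real.sq_sqrt (norm_nonneg _), ← inner_self_eq_norm_sq (𝕜 := ℂ), main,
    ← PosForm.inner_def]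
  calc _ ≤ ‖x‖ * (‖D.W ∘L ContinuousLinearMap.adjoint D.W‖ * ‖x‖) :=
        (RCLike.re_le_norm _).trans ((norm_inner_le_norm _ _).trans (by
          gcongr; exact D.repForm.norm_preRight_le D.algebra D.repForm_mem D.proj_mem x))
    _ = _ := by ring

/-- The coisometry `E_P ⊗_ρ K → M ⊗_P H`, `Y ⊗ k ↦ Φ_Y⋆ W⋆ k`. -/
def toStinespring : D.Tensor →L[ℂ] Stinespring P :=
  (D.preToStinespring.mkContinuous _ D.norm_preToStinespring_le).fromCompletion

theorem toStinespring_tmul (Y : arveson P) (k : K) : D.toStinespring (D.repForm.tmul Y k)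
    = ContinuousLinearMap.adjoint (phi P Y) (ContinuousLinearMap.adjoint D.W k) := by
  rw [toStinespring, PosForm.tmul, ContinuousLinearMap.fromCompletion_apply_coe]; rfl

theorem adjoint_toStinespring_adjoint_phi (Y : arveson P) (h : H) :
    ContinuousLinearMap.adjoint D.toStinespring (ContinuousLinearMap.adjoint (phi P Y) h)
      = D.repForm.tmul Y (D.W h) := by
  refine PosForm.ext_inner_tmul _ fun Z k => ?_
  rw [ContinuousLinearMap.adjoint_inner_right, toStinespring_tmul, inner_adjoint_phi,
    PosForm.inner_tmul, IsometricRep.repForm_apply, D.ρ_W, ContinuousLinearMap.adjoint_inner_left]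

/-- Paired with `Z ⊗ k`, both sides give `⟨W⋆k, Z⋆h⟩`: one by `V(Z)⋆W = WZ⋆`, the other by `Φ_Z(1 ⊗
h) = Z⋆h`. -/
theorem adjoint_tilde_W (h : H) : ContinuousLinearMap.adjoint D.tilde (D.W h)
    = ContinuousLinearMap.adjoint D.toStinespring ((cpForm P).tmul 1 h) := by
  refine PosForm.ext_inner_tmul _ fun Z k => ?_
  rw [ContinuousLinearMap.adjoint_inner_right, ContinuousLinearMap.adjoint_inner_right,
    IsometricRep.tilde_tmul, toStinespring_tmul, ContinuousLinearMap.adjoint_inner_left, phi_tmul,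
    ← ContinuousLinearMap.adjoint_inner_right, ← ContinuousLinearMap.star_eq_adjoint, D.star_V_W,
    ContinuousLinearMap.adjoint_inner_left]
  rfl

/-- On the total vectors `Φ_Y⋆x` the left side passes through `Y ⊗ SWx` to `Φ_Y⋆(W⋆SW)x`, and `Φ_Y⋆`
intertwines. -/
theorem toStinespring_idTensor (hP : IsNormal M (fun A : M => (P A : H →L[ℂ] H)))
    (S : D.algebra) (z : Stinespring P) :
    D.toStinespring (D.idTensor S (ContinuousLinearMap.adjoint D.toStinespring z))
      = stinespringRep P ⟨_, D.compress_mem S.2⟩ z := by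
  let L : Submodule ℂ (Stinespring P) := LinearMap.eqLocus
    (D.toStinespring ∘L D.idTensor S ∘L ContinuousLinearMap.adjoint D.toStinespring).toLinearMap
    (stinespringRep P ⟨_, D.compress_mem S.2⟩).toLinearMap
  refine mem_of_adjoint_phi_mem (L := L) hP
    (isClosed_eq (ContinuousLinearMap.continuous _) (ContinuousLinearMap.continuous _))
    (fun Y x => ?_) z
  change D.toStinespring (D.idTensor S (ContinuousLinearMap.adjoint D.toStinespring
    (ContinuousLinearMap.adjoint (phi P Y) x))) = stinespringRep P ⟨_, D.compress_mem S.2⟩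
      (ContinuousLinearMap.adjoint (phi P Y) x)
  rw [adjoint_toStinespring_adjoint_phi, IsometricRep.idTensor_tmul, toStinespring_tmul,
    adjoint_phi_intertwines]
  rfl

/-- `P(W⋆SW) = W⋆ Θ_V(S) W`. -/
theorem map_compress (hP : IsNormal M (fun A : M => (P A : H →L[ℂ] H))) (S : D.algebra) :
    (P ⟨_, D.compress_mem S.2⟩ : H →L[ℂ] H)
      = ContinuousLinearMap.adjoint D.W ∘L (D.induced S : K →L[ℂ] K) ∘L D.W := by
  ext h
  refine ext_inner_left ℂ fun g => ?_
  change _ = inner ℂ g (ContinuousLinearMap.adjoint D.W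
    (D.tilde (D.idTensor S (ContinuousLinearMap.adjoint D.tilde (D.W h)))))
  rw [ContinuousLinearMap.adjoint_inner_right,
    ← ContinuousLinearMap.adjoint_inner_left D.tilde, adjoint_tilde_W, adjoint_tilde_W, ContinuousLinearMap.adjoint_inner_left,
    D.toStinespring_idTensor hP, stinespringRep_tmul, PosForm.inner_tmul, cpForm_apply, star_one,
    one_mul, mul_one]

/-- It suffices that the projection `ṼṼ⋆` fixes all words. Words `V(Y)k` lie in the range of `Ṽ`;
for `Wh` the unitality of `P` enters through `W⋆ṼṼ⋆W = P(1) = 1`. -/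
theorem tilde_adjoint_tilde (hP1 : P 1 = 1) (hP : IsNormal M (fun A : M => (P A : H →L[ℂ] H)))
    (k : K) : D.tilde (ContinuousLinearMap.adjoint D.tilde k) = k := by
  let L : Submodule ℂ K := LinearMap.eqLocus
    (D.tilde ∘L ContinuousLinearMap.adjoint D.tilde).toLinearMap LinearMap.id
  have hid : D.idTensor 1 = 1 := PosForm.hom_ext _ fun Y k => by
    rw [IsometricRep.idTensor_tmul]; rfl
  have hW : ∀ h, ContinuousLinearMap.adjoint D.W
      (D.tilde (ContinuousLinearMap.adjoint D.tilde (D.W h))) = h := by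
    intro h
    have h1 := D.map_compress hP 1
    have h2 : (⟨_, D.compress_mem (1 : D.algebra).2⟩ : M) = 1 := by
      refine Subtype.ext ?_
      ext h
      exact D.adjoint_W_W h
    rw [h2, hP1] at h1
    have h3 : h = ContinuousLinearMap.adjoint D.W
        (D.tilde (D.idTensor 1 (ContinuousLinearMap.adjoint D.tilde (D.W h)))) :=
      DFunLike.congr_fun h1 h
    rw [hid] at h3
    exact h3.symm
  refine D.mem_of_isWord_mem (L := L) (isClosed_eq (ContinuousLinearMap.continuous _)
    continuous_id) (fun k hk => ?_) k
  change D.tilde (ContinuousLinearMap.adjoint D.tilde k) = k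
  cases hk with
  | step Y hk => rw [← D.tilde_tmul, D.adjoint_tilde_tilde]
  | base h =>
    -- A projection that preserves the norm of a vector fixes it: `⟨q, Wh⟩ = ‖q‖² = ‖Wh‖²` forces `q
    -- = Wh`.
    set q := D.tilde (ContinuousLinearMap.adjoint D.tilde (D.W h)) with hq
    have e1 : inner ℂ q (D.W h) = inner ℂ h h := by
      rw [← ContinuousLinearMap.adjoint_inner_left, hW]
    have e2 : inner ℂ q q = inner ℂ h h := by
      rw [← e1, ← ContinuousLinearMap.adjoint_inner_left D.tilde, hq, D.adjoint_tilde_tilde,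
        ← hq, ContinuousLinearMap.adjoint_inner_left, ← inner_conj_symm, e1, inner_self_conj]
    have e3 : ‖q - D.W h‖ ^ 2 = 0 := by
      rw [norm_sub_sq (𝕜 := ℂ), e1, ← inner_self_eq_norm_sq (𝕜 := ℂ) q, e2, D.isometry_W,
        inner_self_eq_norm_sq]
      ring
    rwa [sq_eq_zero_iff, norm_eq_zero, sub_eq_zero] at e3

/-- `‖Θ_V(S)V(Y)l‖ = ‖V(Y)Sl‖ ≤ ‖V(Y)‖ ‖Sl‖` dominates the vectors `V(Y)l`, which are total since
`Ṽ` is onto. -/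
theorem mem_dominated_inducedHom (hP1 : P 1 = 1)
    (hP : IsNormal M (fun A : M => (P A : H →L[ℂ] H))) (k : K) :
    k ∈ dominated D.inducedHom := by
  rw [← D.tilde_adjoint_tilde hP1 hP k]
  refine D.repForm.mem_of_tmul_mem (L := (dominated D.inducedHom).comap D.tilde.toLinearMap)
    ((isClosed_dominated _).preimage D.tilde.continuous) (fun Y l => ?_) _
  change D.tilde (D.repForm.tmul Y l) ∈ dominated D.inducedHom
  rw [D.tilde_tmul]
  refine mem_dominated_of_le l ‖D.V Y‖ fun S => ?_
  change ‖D.inducedAux S (D.V Y l)‖ ≤ _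
  rw [D.inducedAux_V]
  exact (D.V Y).le_opNorm _

theorem exists_endomorphism (hP1 : P 1 = 1)
    (hP : IsNormal M (fun A : M => (P A : H →L[ℂ] H))) :
    ∃ θ : D.algebra →⋆ₐ[ℂ] D.algebra, (∀ S, θ S = D.induced S) ∧
      IsNormal D.algebra (fun S : D.algebra => (θ S : K →L[ℂ] K)) := by
  have h1 : D.induced 1 = 1 := by
    refine Subtype.ext ?_
    have hid : D.idTensor 1 = 1 := PosForm.hom_ext _ fun Y k => by
      rw [IsometricRep.idTensor_tmul]; rfl
    ext k
    change D.tilde (D.idTensor 1 (ContinuousLinearMap.adjoint D.tilde k)) = k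
    rw [hid]
    exact D.tilde_adjoint_tilde hP1 hP k
  refine ⟨{ toFun := D.induced
            map_one' := h1
            map_mul' := fun S T => Subtype.ext (map_mul D.inducedHom S T)
            map_zero' := Subtype.ext (map_zero D.inducedHom)
            map_add' := fun S T => Subtype.ext (map_add D.inducedHom S T)
            commutes' := fun c => ?_
            map_star' := fun S => Subtype.ext (map_star D.inducedHom S) }, fun S => rfl,
    isNormal_of_dominated D.inducedHom (D.mem_dominated_inducedHom hP1 hP)⟩
  rw [Algebra.algebraMap_eq_smul_one]
  have h2 : D.induced (c • 1) = c • D.induced 1 := Subtype.ext (map_smul D.inducedHom c 1)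
  exact h2.trans (by rw [h1])

/-- The induction closes because `map_compress` holds on all of `R`, not only on the corner: it
applies to `Θ_Vⁿ(S)`. -/
theorem iterate_compress (hP : IsNormal M (fun A : M => (P A : H →L[ℂ] H))) (n : ℕ)
    (S : D.algebra) : ((⇑P)^[n] ⟨_, D.compress_mem S.2⟩ : H →L[ℂ] H)
      = ContinuousLinearMap.adjoint D.W ∘L (D.induced^[n] S : K →L[ℂ] K) ∘L D.W := by
  induction n with
  | zero => rfl
  | succ n ih =>
    rw [Function.iterate_succ_apply', Function.iterate_succ_apply', ← D.map_compress hP]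
    exact congrArg (fun A : M => (P A : H →L[ℂ] H)) (Subtype.ext ih)

end MinimalIsometricDilation

end Endomorphism

/-! ### The positive definite kernel on finite sequences in `M` -/

section Kernel

variable {H : Type u} [NormedAddCommGroup H] [InnerProductSpace ℂ H] [CompleteSpace H]
variable {M : VonNeumannAlgebra H}

theorem cstarMatrix_inner_nonneg {n : ℕ} {X : CStarMatrix (Fin n) (Fin n) M} (hX : 0 ≤ X)
    (h : Fin n → H) : 0 ≤ ∑ i, ∑ j, inner ℂ (h i) ((X i j : H →L[ℂ] H) (h j)) := by
  rw [StarOrderedRing.nonneg_iff] at hX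
  induction hX using AddSubmonoid.closure_induction with
  | zero => simp
  | add X Y _ _ hx hy =>
    simpa [Finset.sum_add_distrib, inner_add_right] using add_nonneg hx hy
  | mem X hX =>
    obtain ⟨Y, rfl⟩ := hX
    have e : ∀ i j, inner ℂ (h i) (((star Y * Y) i j : H →L[ℂ] H) (h j))
        = ∑ k, inner ℂ ((Y k i : H →L[ℂ] H) (h i)) ((Y k j : H →L[ℂ] H) (h j)) := by
      intro i j
      have e1 : (((star Y * Y) i j : M) : H →L[ℂ] H)
          = ∑ k, star (Y k i : H →L[ℂ] H) * (Y k j : H →L[ℂ] H) := by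
        simp [CStarMatrix.mul_apply, CStarMatrix.star_apply]
      rw [e1, sum_apply, inner_sum]
      refine Finset.sum_congr rfl fun k _ => ?_
      rw [mul_apply_eq_comp, ContinuousLinearMap.star_eq_adjoint,
        ContinuousLinearMap.adjoint_inner_right]
    have : ∑ i, ∑ j, inner ℂ (h i) (((star Y * Y) i j : H →L[ℂ] H) (h j))
        = ∑ k, inner ℂ (∑ i, (Y k i : H →L[ℂ] H) (h i)) (∑ j, (Y k j : H →L[ℂ] H) (h j)) := by
      simp only [e, sum_inner, inner_sum]
      calc _ = ∑ i, ∑ k, ∑ j, inner ℂ ((Y k i : H →L[ℂ] H) (h i)) ((Y k j : H →L[ℂ] H) (h j)) :=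
            Finset.sum_congr rfl fun i _ => Finset.sum_comm
        _ = _ := by
            rw [Finset.sum_comm]
            exact Finset.sum_congr rfl fun k _ => Finset.sum_comm
    rw [this]
    refine Finset.sum_nonneg fun k _ => ?_
    rw [inner_self_eq_norm_sq_to_K]
    simp

theorem cstarMatrix_one_nonneg (n : ℕ) :
    0 ≤ (CStarMatrix.ofMatrix fun _ _ => 1 : CStarMatrix (Fin n) (Fin n) M) := by
  rcases Nat.eq_zero_or_pos n with rfl | hn
  · refine le_of_eq ?_
    ext i
    exact i.elim0
  · let Y : CStarMatrix (Fin n) (Fin n) M :=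
      CStarMatrix.ofMatrix fun i _ => if i = ⟨0, hn⟩ then 1 else 0
    have hY : ∀ k j, Y k j = if k = ⟨0, hn⟩ then 1 else 0 := fun _ _ => rfl
    have : (CStarMatrix.ofMatrix fun _ _ => 1 : CStarMatrix (Fin n) (Fin n) M) = star Y * Y := by
      ext i j : 2
      rw [CStarMatrix.mul_apply, Finset.sum_eq_single ⟨0, hn⟩]
      · rw [CStarMatrix.star_apply, hY, hY, if_pos rfl, star_one, one_mul]; rfl
      · intro k _ hk
        rw [hY k j, if_neg hk, mul_zero]
      · simp
    rw [this]
    exact star_mul_self_nonneg Y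

/-- Conjugation of `X` by the diagonal matrix of the `d i`. -/
theorem cstarMatrix_conj_nonneg {n : ℕ} {X : CStarMatrix (Fin n) (Fin n) M} (hX : 0 ≤ X)
    (d : Fin n → M) :
    0 ≤ (CStarMatrix.ofMatrix fun i j => star (d i) * X i j * d j :
      CStarMatrix (Fin n) (Fin n) M) := by
  let E : CStarMatrix (Fin n) (Fin n) M :=
    CStarMatrix.ofMatrix fun i j => if i = j then d j else 0
  have hE : ∀ k j, E k j = if k = j then d j else 0 := fun _ _ => rfl
  have : (CStarMatrix.ofMatrix fun i j => star (d i) * X i j * d j :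
      CStarMatrix (Fin n) (Fin n) M) = star E * X * E := by
    ext i j : 2
    rw [CStarMatrix.mul_apply, Finset.sum_eq_single j]
    · rw [hE, if_pos rfl, CStarMatrix.mul_apply, Finset.sum_eq_single i]
      · rw [CStarMatrix.star_apply, hE, if_pos rfl]; rfl
      · intro k _ hk
        rw [CStarMatrix.star_apply, hE, if_neg hk, star_zero, zero_mul]
      · simp
    · intro k _ hk
      rw [hE, if_neg hk, mul_zero]
    · simp
  rw [this]
  exact star_left_conjugate_nonneg hX E

/-- The kernel `k(T, S) = P(T₀⋆ P(T₁⋆ P(⋯) S₁) S₀)` on finite sequences in `M`, where sequences of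
different lengths are continued by `1`. -/
def pathKernel (P : M →CP M) : List M → List M → M
  | [], [] => 1
  | T :: Ts, [] => P (star T * pathKernel P Ts [] * 1)
  | [], S :: Ss => P (star 1 * pathKernel P [] Ss * S)
  | T :: Ts, S :: Ss => P (star T * pathKernel P Ts Ss * S)
termination_by T S => T.length + S.length

variable {P : M →CP M}

/-- Padding by `1` merges the four cases into one recursion; for two empty lists this is `P 1 = 1`.
-/
theorem pathKernel_eq (hP : P 1 = 1) (T S : List M) : pathKernel P T S
    = P (star (T.headD 1) * pathKernel P T.tail S.tail * S.headD 1) := by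
  cases T <;> cases S <;> simp [pathKernel, hP]

theorem star_pathKernel (T S : List M) : star (pathKernel P T S) = pathKernel P S T := by
  fun_induction pathKernel P T S <;> simp_all [pathKernel, ← map_star, mul_assoc]

/-- Induction on a common bound for the lengths: the matrix of the tails is conjugated by the heads,
and `P` is applied entrywise. At length `0` all entries are `1`. -/
theorem pathKernel_matrix_nonneg (hP : P 1 = 1) {n : ℕ} (m : ℕ) (T : Fin n → List M)
    (hT : ∀ i, (T i).length ≤ m) : 0 ≤ (CStarMatrix.ofMatrix fun i j => pathKernel P (T i) (T j) :
      CStarMatrix (Fin n) (Fin n) M) := by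
  induction m generalizing T with
  | zero =>
    have h0 : ∀ i, T i = [] := fun i => List.length_eq_zero_iff.1 (Nat.le_zero.1 (hT i))
    convert cstarMatrix_one_nonneg (M := M) n using 1
    ext i j : 2
    change ((pathKernel P (T i) (T j) : M) : H →L[ℂ] H) = (1 : M)
    rw [h0, h0, pathKernel]
  | succ m ih =>
    have h1 := cstarMatrix_conj_nonneg (ih (fun i => (T i).tail) fun i => by
      have := hT i
      rw [List.length_tail]
      omega) fun i => (T i).headD 1
    have h2 := P.map_cstarMatrix_nonneg' n _ h1
    convert h2 using 1
    ext i j : 2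
    exact congrArg Subtype.val (pathKernel_eq hP (T i) (T j))

theorem pathKernel_nonneg (hP : P 1 = 1) (s : Finset (List M)) (g : List M → H) :
    0 ≤ ∑ T ∈ s, ∑ S ∈ s, inner ℂ (g T) ((pathKernel P T S : H →L[ℂ] H) (g S)) := by
  let e := s.equivFin
  have h1 := cstarMatrix_inner_nonneg (pathKernel_matrix_nonneg hP (s.sup List.length)
    (fun i => (e.symm i : List M)) fun i => Finset.le_sup (f := List.length) (e.symm i).2)
    fun i => g (e.symm i)
  have h2 : ∀ F : List M → List M → ℂ, ∑ i, ∑ j, F (e.symm i) (e.symm j)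
      = ∑ T ∈ s, ∑ S ∈ s, F T S := by
    intro F
    rw [e.symm.sum_comp fun T : s => ∑ j, F T (e.symm j), ← Finset.sum_coe_sort s]
    refine Finset.sum_congr rfl fun T _ => ?_
    rw [e.symm.sum_comp fun S : s => F T S, ← Finset.sum_coe_sort s]
  rw [← h2]
  exact h1

/-- The sesquilinear extension of the kernel to the free vector space on finite sequences in `M`. -/
def pathForm (hP : P 1 = 1) : PosForm (List M →₀ ℂ) H where
  form := LinearMap.mk₂'ₛₗ (starRingEnd ℂ) (RingHom.id ℂ)
    (fun a b => a.sum fun T c => b.sum fun S d =>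
      (starRingEnd ℂ c * d) • (pathKernel P T S : H →L[ℂ] H))
    (fun a a' b => Finsupp.sum_add_index' (by simp) fun T c c' => by
      simp only [map_add, add_mul, add_smul, Finsupp.sum_add])
    (fun c a b => by
      rw [Finsupp.sum_smul_index' (by simp), Finsupp.smul_sum]
      refine Finsupp.sum_congr fun T _ => ?_
      rw [Finsupp.smul_sum]
      simp [smul_smul, mul_assoc])
    (fun a b b' => by
      rw [← Finsupp.sum_add]
      refine Finsupp.sum_congr fun T _ => ?_
      exact Finsupp.sum_add_index' (by simp) fun S d d' => by rw [mul_add, add_smul])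
    (fun c a b => by
      rw [Finsupp.smul_sum]
      refine Finsupp.sum_congr fun T _ => ?_
      rw [Finsupp.sum_smul_index' (by simp), Finsupp.smul_sum]
      simp [smul_smul, mul_left_comm])
  star_form a b := by
    change star (a.sum fun T c => b.sum fun S d =>
        (starRingEnd ℂ c * d) • (pathKernel P T S : H →L[ℂ] H))
      = b.sum fun S d => a.sum fun T c =>
        (starRingEnd ℂ d * c) • (pathKernel P S T : H →L[ℂ] H)
    rw [Finsupp.sum_comm, Finsupp.sum, star_sum]
    refine Finset.sum_congr rfl fun S _ => ?_
    rw [Finsupp.sum, star_sum]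
    refine Finset.sum_congr rfl fun T _ => ?_
    rw [star_smul, ← star_pathKernel S T]
    simp [mul_comm]
  nonneg n a h := by
    classical
    let s : Finset (List M) := Finset.univ.biUnion fun i => (a i).support
    -- Collecting the vectors attached to each path reduces the form on the free space to the kernel
    -- itself.
    let g : List M → H := fun T => ∑ i, a i T • h i
    have hs : ∀ i, (a i).support ⊆ s := fun i =>
      Finset.subset_biUnion_of_mem (fun i => (a i).support) (Finset.mem_univ i)
    have e : ∀ i j, inner ℂ (h i) (((a i).sum fun T c => (a j).sum fun S d =>
          (starRingEnd ℂ c * d) • (pathKernel P T S : H →L[ℂ] H)) (h j))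
        = ∑ T ∈ s, ∑ S ∈ s, inner ℂ (a i T • h i)
            ((pathKernel P T S : H →L[ℂ] H) (a j S • h j)) := by
      intro i j
      rw [Finsupp.sum_of_support_subset _ (hs i) _ (by simp), sum_apply, inner_sum]
      refine Finset.sum_congr rfl fun T _ => ?_
      rw [Finsupp.sum_of_support_subset _ (hs j) _ (by simp), sum_apply, inner_sum]
      refine Finset.sum_congr rfl fun S _ => ?_
      rw [smul_apply, map_smul, inner_smul_right, inner_smul_right, inner_smul_left]
      ring
    have e2 : ∑ i, ∑ j, inner ℂ (h i) (((a i).sum fun T c => (a j).sum fun S d =>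
          (starRingEnd ℂ c * d) • (pathKernel P T S : H →L[ℂ] H)) (h j))
        = ∑ T ∈ s, ∑ S ∈ s, inner ℂ (g T) ((pathKernel P T S : H →L[ℂ] H) (g S)) := by
      simp only [e, g, map_sum, sum_inner, inner_sum]
      calc _ = ∑ i, ∑ T ∈ s, ∑ j, ∑ S ∈ s, inner ℂ (a i T • h i)
              ((pathKernel P T S : H →L[ℂ] H) (a j S • h j)) :=
            Finset.sum_congr rfl fun i _ => Finset.sum_comm
        _ = ∑ T ∈ s, ∑ i, ∑ S ∈ s, ∑ j, inner ℂ (a i T • h i)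
              ((pathKernel P T S : H →L[ℂ] H) (a j S • h j)) := by
            rw [Finset.sum_comm]
            exact Finset.sum_congr rfl fun T _ => Finset.sum_congr rfl fun i _ => Finset.sum_comm
        _ = ∑ T ∈ s, ∑ S ∈ s, ∑ i, ∑ j, inner ℂ (a i T • h i)
              ((pathKernel P T S : H →L[ℂ] H) (a j S • h j)) :=
            Finset.sum_congr rfl fun T _ => Finset.sum_comm
        _ = _ := by
            refine Finset.sum_congr rfl fun T _ => Finset.sum_congr rfl fun S _ => ?_
            exact Finset.sum_comm
    have h3 := (Complex.nonneg_iff.1 (pathKernel_nonneg hP s g)).1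
    rw [← e2] at h3
    exact h3

theorem pathForm_single (hP : P 1 = 1) (T S : List M) :
    (pathForm hP).form (Finsupp.single T 1) (Finsupp.single S 1) = pathKernel P T S := by
  change ((Finsupp.single T 1).sum fun T c => (Finsupp.single S 1).sum fun S d =>
    (starRingEnd ℂ c * d) • (pathKernel P T S : H →L[ℂ] H)) = _
  rw [Finsupp.sum_single_index (by simp), Finsupp.sum_single_index (by simp)]
  simp

theorem pathForm_mem (hP : P 1 = 1) (a b : List M →₀ ℂ) :
    (pathForm hP).form a b ∈ M.commutant.commutant := by
  rw [M.commutant_commutant]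
  exact sum_mem fun T _ => sum_mem fun S _ => SMulMemClass.smul_mem _ (pathKernel P T S).2

end Kernel

/-! ### Construction of the minimal isometric dilation -/

section PathSpace

variable {H : Type u} [NormedAddCommGroup H] [InnerProductSpace ℂ H] [CompleteSpace H]
variable {M : VonNeumannAlgebra H} {P : M →CP M} (hP : P 1 = 1)

/-- The space of the dilation, spanned by vectors `⋯ ⊗ 1 ⊗ Tₙ ⊗ ⋯ ⊗ T₀ ⊗ h`. -/
abbrev PathSpace : Type u := (pathForm hP).Space

/-- The operator `h ↦ ⋯ ⊗ 1 ⊗ Tₙ ⊗ ⋯ ⊗ T₀ ⊗ h`. -/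
def pathVec (T : List M) : H →L[ℂ] PathSpace hP := (pathForm hP).tmulL (Finsupp.single T 1)

theorem inner_pathVec (T S : List M) (h k : H) : inner ℂ (pathVec hP T h) (pathVec hP S k)
    = inner ℂ h ((pathKernel P T S : H →L[ℂ] H) k) := by
  rw [pathVec, pathVec, PosForm.tmulL_apply, PosForm.tmulL_apply, PosForm.inner_tmul,
    pathForm_single]

theorem path_pre_induction {p : (pathForm hP).Pre → Prop} (x : (pathForm hP).Pre) (h0 : p 0)
    (h1 : ∀ T h, p ((pathForm hP).pure (Finsupp.single T 1) h))
    (h2 : ∀ x y, p x → p y → p (x + y)) : p x := by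
  induction x using PosForm.pre_induction with
  | h0 => exact h0
  | h2 x y hx hy => exact h2 x y hx hy
  | h1 a h =>
    induction a using Finsupp.induction_linear with
    | zero => rw [map_zero, LinearMap.zero_apply]; exact h0
    | add a b ha hb => rw [map_add, LinearMap.add_apply]; exact h2 _ _ ha hb
    | single T c =>
      have e : Finsupp.single T c = c • Finsupp.single T (1 : ℂ) := by simp
      rw [e, map_smul, LinearMap.smul_apply, ← map_smul]
      exact h1 T _

theorem mem_of_pathVec_mem {L : Submodule ℂ (PathSpace hP)}
    (hL : IsClosed (L : Set (PathSpace hP))) (h : ∀ T x, pathVec hP T x ∈ L) (z : PathSpace hP) :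
    z ∈ L := by
  induction z using UniformSpace.Completion.induction_on with
  | hp => exact hL
  | ih x =>
    induction x using path_pre_induction with
    | h0 => rw [UniformSpace.Completion.coe_zero]; exact L.zero_mem
    | h1 T x => exact h T x
    | h2 x y hx hy => rw [UniformSpace.Completion.coe_add]; exact L.add_mem hx hy

theorem path_hom_ext {X : Type w} [NormedAddCommGroup X] [NormedSpace ℂ X]
    {f g : PathSpace hP →L[ℂ] X} (h : ∀ T x, f (pathVec hP T x) = g (pathVec hP T x)) : f = g := by
  ext z
  exact mem_of_pathVec_mem hP (L := LinearMap.eqLocus f.toLinearMap g.toLinearMap)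
    (isClosed_eq f.continuous g.continuous) h z

theorem path_ext_inner {x y : PathSpace hP}
    (h : ∀ T k, inner ℂ (pathVec hP T k) x = inner ℂ (pathVec hP T k) y) : x = y := by
  refine ext_inner_right ℂ fun z => ?_
  have e : innerSL ℂ x = innerSL ℂ y := path_hom_ext hP fun T k => by
    rw [innerSL_apply_apply, innerSL_apply_apply, ← inner_conj_symm, h, inner_conj_symm]
  exact DFunLike.congr_fun e z

theorem pathKernel_cons (hP : P 1 = 1) (T T' : List M) (S : M) : pathKernel P T' (S :: T)
    = P (star (T'.headD 1) * pathKernel P T'.tail T * S) := by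
  rw [pathKernel_eq hP]
  rfl

/-- The outermost `P` of the kernel is the inner product of `M ⊗_P H`; the remaining letters act
through `π_P`. -/
theorem inner_pathVec_cons (T T' : List M) (S : M) (g h : H) :
    inner ℂ (pathVec hP T' h) (pathVec hP (S :: T) g)
      = inner ℂ ((cpForm P).tmul (T'.headD 1) h)
          (stinespringRep P (pathKernel P T'.tail T) ((cpForm P).tmul S g)) := by
  rw [inner_pathVec, pathKernel_cons hP, stinespringRep_tmul, PosForm.inner_tmul, cpForm_apply,
    mul_assoc]

/-- `S ⊗ h ↦ ⋯ ⊗ T₁ ⊗ T₀ ⊗ S ⊗ h` on the algebraic tensor product. -/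
def prePathInsert (T : List M) : (cpForm P).Pre →ₗ[ℂ] PathSpace hP :=
  (cpForm P).lift (LinearMap.mk₂ ℂ (fun S h => pathVec hP (S :: T) h)
    -- Paths are basis vectors of a free space, so linearity in the letter `S` holds only in the
    -- completion, where it is tested against all paths.
    (fun S S' h => path_ext_inner hP fun T' k => by
      rw [inner_add_right, inner_pathVec, inner_pathVec, inner_pathVec, pathKernel_cons hP,
        pathKernel_cons hP, pathKernel_cons hP, mul_add, map_add, ← inner_add_right]
      rfl)
    (fun c S h => path_ext_inner hP fun T' k => by
      rw [inner_smul_right, inner_pathVec, inner_pathVec, pathKernel_cons hP,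
        pathKernel_cons hP, mul_smul_comm, map_smul, ← inner_smul_right]
      rfl)
    (fun S h h' => map_add _ _ _) (fun c S h => map_smul _ _ _))

theorem prePathInsert_pure (T : List M) (S : M) (h : H) :
    prePathInsert hP T ((cpForm P).pure S h) = pathVec hP (S :: T) h := rfl

theorem norm_prePathInsert_le (T : List M) (x : (cpForm P).Pre) :
    ‖prePathInsert hP T x‖ ≤ √‖(pathKernel P T T : H →L[ℂ] H)‖ * ‖x‖ := by
  have main : ∀ x y, inner ℂ (prePathInsert hP T x) (prePathInsert hP T y)
      = (cpForm P).gram x (preLeft P (pathKernel P T T) y) := by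
    intro x y
    induction x using PosForm.pre_induction with
    | h0 => simp
    | h2 x x' hx hx' => simp only [map_add, LinearMap.add_apply, inner_add_left, hx, hx']
    | h1 a h =>
      induction y using PosForm.pre_induction with
      | h0 => simp
      | h2 y y' hy hy' => simp only [map_add, inner_add_right, hy, hy']
      | h1 b k =>
        rw [prePathInsert_pure, prePathInsert_pure, inner_pathVec_cons, stinespringRep_tmul,
          PosForm.inner_tmul, preLeft_pure, PosForm.gram_pure]
        rfl
  refine le_of_sq_le_sq ?_ (by positivity)
  rw [mul_pow, Real.sq_sqrt (norm_nonneg _), ← inner_self_eq_norm_sq (𝕜 := ℂ), main,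
    ← PosForm.inner_def]
  calc _ ≤ ‖x‖ * (‖(pathKernel P T T : H →L[ℂ] H)‖ * ‖x‖) :=
        (RCLike.re_le_norm _).trans ((norm_inner_le_norm _ _).trans (by
          gcongr; exact norm_preLeft_le P _ x))
    _ = _ := by ring

/-- The operator `S ⊗ h ↦ ⋯ ⊗ T₁ ⊗ T₀ ⊗ S ⊗ h` on `M ⊗_P H`. -/
def pathInsert (T : List M) : Stinespring P →L[ℂ] PathSpace hP :=
  ((prePathInsert hP T).mkContinuous _ (norm_prePathInsert_le hP T)).fromCompletion

theorem pathInsert_tmul (T : List M) (S : M) (h : H) :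
    pathInsert hP T ((cpForm P).tmul S h) = pathVec hP (S :: T) h := by
  rw [pathInsert, PosForm.tmul, ContinuousLinearMap.fromCompletion_apply_coe]; rfl

theorem inner_pathVec_pathInsert (T' T : List M) (h : H) (z : Stinespring P) :
    inner ℂ (pathVec hP T' h) (pathInsert hP T z)
      = inner ℂ ((cpForm P).tmul (T'.headD 1) h)
          (stinespringRep P (pathKernel P T'.tail T) z) := by
  have e : innerSL ℂ (pathVec hP T' h) ∘L pathInsert hP T
      = innerSL ℂ ((cpForm P).tmul (T'.headD 1) h) ∘L
        stinespringRep P (pathKernel P T'.tail T) :=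
    PosForm.hom_ext _ fun S g => by
      rw [ContinuousLinearMap.comp_apply, ContinuousLinearMap.comp_apply, innerSL_apply_apply,
        innerSL_apply_apply, pathInsert_tmul, inner_pathVec_cons]
  exact DFunLike.congr_fun e z

theorem adjoint_pathInsert_pathInsert (T T' : List M) (z : Stinespring P) :
    ContinuousLinearMap.adjoint (pathInsert hP T) (pathInsert hP T' z)
      = stinespringRep P (pathKernel P T T') z :=
  PosForm.ext_inner_tmul _ fun S g => by
    rw [ContinuousLinearMap.adjoint_inner_right, pathInsert_tmul, inner_pathVec_pathInsert]
    rfl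

/-- `Φ_Y π_P(A) Φ_Z⋆ = ⟨Y, Z⟩A = A⟨Y, Z⟩` with `A` the kernel value; this becomes `V(Y)⋆V(Z) = ρ(⟨Y,
Z⟩)`. -/
theorem inner_pathInsert_adjoint_phi (Y Z : arveson P) (T T' : List M) (h k : H) :
    inner ℂ (pathInsert hP T (ContinuousLinearMap.adjoint (phi P Y) h))
        (pathInsert hP T' (ContinuousLinearMap.adjoint (phi P Z) k))
      = inner ℂ (pathVec hP T h) (pathVec hP T' ((arvesonInner P Y Z : H →L[ℂ] H) k)) := by
  rw [← ContinuousLinearMap.adjoint_inner_right, adjoint_pathInsert_pathInsert,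
    adjoint_phi_intertwines, ContinuousLinearMap.adjoint_inner_left, ← arvesonInner_apply,
    inner_pathVec]
  congr 1
  exact (DFunLike.congr_fun (mul_comm_of_mem (pathKernel P T T').2 (arvesonInner P Y Z).2) k).symm

/-- The representation `B ↦ I ⊗ B` of `M'`. -/
def pathRep (B : M.commutant) : PathSpace hP →L[ℂ] PathSpace hP :=
  (pathForm hP).right M.commutant (pathForm_mem hP) B

theorem pathRep_pathVec (B : M.commutant) (T : List M) (h : H) :
    pathRep hP B (pathVec hP T h) = pathVec hP T ((B : H →L[ℂ] H) h) :=
  PosForm.right_tmul _ _ _ _ _ _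

theorem inner_pathVec_pathRep (B : M.commutant) (T : List M) (h : H) (z : PathSpace hP) :
    inner ℂ (pathVec hP T h) (pathRep hP B z)
      = inner ℂ (pathVec hP T ((star B : H →L[ℂ] H) h)) z := by
  have e : innerSL ℂ (pathVec hP T h) ∘L pathRep hP B
      = innerSL ℂ (pathVec hP T ((star B : H →L[ℂ] H) h)) := path_hom_ext hP fun S k => by
    rw [ContinuousLinearMap.comp_apply, innerSL_apply_apply, innerSL_apply_apply, pathRep_pathVec,
      inner_pathVec, inner_pathVec, ContinuousLinearMap.star_eq_adjoint,
      ContinuousLinearMap.adjoint_inner_left]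
    congr 1
    exact DFunLike.congr_fun (mul_comm_of_mem (pathKernel P T S).2 B.2) k
  exact DFunLike.congr_fun e z

/-- The representation `B ↦ I ⊗ B` of `M'` as a `*`-homomorphism. -/
def pathHom : M.commutant →⋆ₙₐ[ℂ] (PathSpace hP →L[ℂ] PathSpace hP) where
  toFun := pathRep hP
  map_smul' c B := path_hom_ext hP fun T h => by
    rw [smul_apply, pathRep_pathVec, pathRep_pathVec, ← map_smul]
    rfl
  map_zero' := path_hom_ext hP fun T h => by
    rw [pathRep_pathVec]
    exact map_zero (pathVec hP T)
  map_add' B C := path_hom_ext hP fun T h => by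
    rw [add_apply, pathRep_pathVec, pathRep_pathVec, pathRep_pathVec, ← map_add]
    rfl
  map_mul' B C := path_hom_ext hP fun T h => by
    rw [mul_apply_eq_comp, pathRep_pathVec, pathRep_pathVec, pathRep_pathVec]
    rfl
  map_star' B := path_hom_ext hP fun T h => path_ext_inner hP fun S k => by
    rw [inner_pathVec_pathRep, ContinuousLinearMap.star_eq_adjoint (pathRep hP B),
      ContinuousLinearMap.adjoint_inner_right, pathRep_pathVec]
    congr 2
    exact DFunLike.congr_fun (star_star (B : H →L[ℂ] H)) k

theorem pathHom_pathVec (B : M.commutant) (T : List M) (h : H) :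
    pathHom hP B (pathVec hP T h) = pathVec hP T ((B : H →L[ℂ] H) h) := pathRep_pathVec hP B T h

theorem isNormal_pathHom : IsNormal M.commutant (pathHom hP) :=
  isNormal_of_dominated _ fun k => mem_of_pathVec_mem hP (isClosed_dominated _) (fun T h =>
    mem_dominated_of_le h ‖pathVec hP T‖ fun B => by
      rw [pathHom_pathVec]
      exact (pathVec hP T).le_opNorm _) k

/-- `T ⊗ h ↦ ⋯ ⊗ T₁ ⊗ T₀ ⊗ Φ_Y⋆ h` on the algebraic tensor product. -/
def prePathV (Y : arveson P) : (pathForm hP).Pre →ₗ[ℂ] PathSpace hP :=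
  (pathForm hP).lift (Finsupp.linearCombination ℂ fun T =>
    (pathInsert hP T ∘L ContinuousLinearMap.adjoint (phi P Y)).toLinearMap)

theorem prePathV_pure (Y : arveson P) (T : List M) (h : H) :
    prePathV hP Y ((pathForm hP).pure (Finsupp.single T 1) h)
      = pathInsert hP T (ContinuousLinearMap.adjoint (phi P Y) h) := by
  rw [prePathV, PosForm.lift_pure, Finsupp.linearCombination_single, one_smul]
  rfl

theorem norm_prePathV_le (Y : arveson P) (x : (pathForm hP).Pre) :
    ‖prePathV hP Y x‖ ≤ √‖(arvesonInner P Y Y : H →L[ℂ] H)‖ * ‖x‖ := by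
  have main : ∀ x y, inner ℂ (prePathV hP Y x) (prePathV hP Y y)
      = (pathForm hP).gram x ((pathForm hP).preRight (arvesonInner P Y Y) y) := by
    intro x y
    induction x using path_pre_induction with
    | h0 => simp
    | h2 x x' hx hx' => simp only [map_add, LinearMap.add_apply, inner_add_left, hx, hx']
    | h1 a h =>
      induction y using path_pre_induction with
      | h0 => simp
      | h2 y y' hy hy' => simp only [map_add, inner_add_right, hy, hy']
      | h1 b k =>
        rw [prePathV_pure, prePathV_pure, inner_pathInsert_adjoint_phi, PosForm.preRight_pure,
          PosForm.gram_pure, inner_pathVec, pathForm_single]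
  refine le_of_sq_le_sq ?_ (by positivity)
  rw [mul_pow, Real.sq_sqrt (norm_nonneg _), ← inner_self_eq_norm_sq (𝕜 := ℂ), main,
    ← PosForm.inner_def]
  calc _ ≤ ‖x‖ * (‖(arvesonInner P Y Y : H →L[ℂ] H)‖ * ‖x‖) :=
        (RCLike.re_le_norm _).trans ((norm_inner_le_norm _ _).trans (by
          gcongr; exact (pathForm hP).norm_preRight_le _ (pathForm_mem hP)
            (arvesonInner P Y Y).2 x))
    _ = _ := by ring

/-- The operator `V(Y) : T ⊗ h ↦ ⋯ ⊗ T₁ ⊗ T₀ ⊗ Φ_Y⋆ h`. -/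
def pathV (Y : arveson P) : PathSpace hP →L[ℂ] PathSpace hP :=
  ((prePathV hP Y).mkContinuous _ (norm_prePathV_le hP Y)).fromCompletion

theorem pathV_pathVec (Y : arveson P) (T : List M) (h : H) : pathV hP Y (pathVec hP T h)
    = pathInsert hP T (ContinuousLinearMap.adjoint (phi P Y) h) := by
  rw [pathV, pathVec, PosForm.tmulL_apply, PosForm.tmul,
    ContinuousLinearMap.fromCompletion_apply_coe]
  exact prePathV_pure hP Y T h

/-- Explicit matrix coefficients of `V(Y)`, from which covariance and the action of `V(Y)⋆` are read
off. -/
theorem inner_pathVec_pathV (Y : arveson P) (T' T : List M) (g h : H) :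
    inner ℂ (pathVec hP T' g) (pathV hP Y (pathVec hP T h))
      = inner ℂ (((T'.headD 1 : M) : H →L[ℂ] H) (star (Y : H →L[ℂ] H) g))
          ((pathKernel P T'.tail T : H →L[ℂ] H) h) := by
  rw [pathV_pathVec, inner_pathVec_pathInsert, adjoint_phi_intertwines,
    ContinuousLinearMap.adjoint_inner_right, phi_tmul]

theorem pathV_lact (S : M.commutant) (Y : arveson P) :
    pathV hP (lact P S Y) = pathHom hP S * pathV hP Y :=
  path_hom_ext hP fun T h => path_ext_inner hP fun T' g => by
    change inner ℂ _ (pathV hP (lact P S Y) _) = inner ℂ _ (pathRep hP S (pathV hP Y _))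
    rw [inner_pathVec_pathRep, inner_pathVec_pathV, inner_pathVec_pathV]
    congr 2
    change star ((S : H →L[ℂ] H) * Y) g = _
    rw [star_mul]
    rfl

theorem pathV_ract (Y : arveson P) (S : M.commutant) :
    pathV hP (ract P Y S) = pathV hP Y * pathHom hP S :=
  path_hom_ext hP fun T h => path_ext_inner hP fun T' g => by
    change inner ℂ _ (pathV hP (ract P Y S) _) = inner ℂ _ (pathV hP Y (pathRep hP S _))
    rw [pathRep_pathVec, inner_pathVec_pathV, inner_pathVec_pathV]
    have e1 := DFunLike.congr_fun (mul_comm_of_mem (pathKernel P T'.tail T).2 S.2) h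
    have e2 := DFunLike.congr_fun (mul_comm_of_mem (T'.headD 1).2 (star_mem S.2))
      (star (Y : H →L[ℂ] H) g)
    rw [mul_apply_eq_comp, mul_apply_eq_comp] at e1 e2
    rw [e1, ← ContinuousLinearMap.adjoint_inner_left (S : H →L[ℂ] H),
      ← ContinuousLinearMap.star_eq_adjoint (S : H →L[ℂ] H), ← e2]
    congr 2
    change star ((Y : H →L[ℂ] H) * S) g = _
    rw [star_mul]
    rfl

theorem star_pathV_mul_pathV (Y Z : arveson P) :
    star (pathV hP Y) * pathV hP Z = pathHom hP (arvesonInner P Y Z) :=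
  path_hom_ext hP fun T h => path_ext_inner hP fun T' g => by
    rw [mul_apply_eq_comp, ContinuousLinearMap.star_eq_adjoint,
      ContinuousLinearMap.adjoint_inner_right, pathV_pathVec, pathV_pathVec,
      inner_pathInsert_adjoint_phi, pathHom_pathVec]

/-- The isometric covariant representation of the Arveson correspondence on the path space. -/
def pathIsometricRep : IsometricRep P (PathSpace hP) where
  V :=
    { toFun := pathV hP
      map_add' := fun Y Z => path_hom_ext hP fun T h => by
        rw [add_apply, pathV_pathVec, pathV_pathVec, pathV_pathVec, adjoint_phi_add, add_apply,
          map_add]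
      map_smul' := fun c Y => path_hom_ext hP fun T h => by
        rw [smul_apply, pathV_pathVec, pathV_pathVec, adjoint_phi_smul, smul_apply, map_smul]
        rfl }
  ρ := pathHom hP
  normal := isNormal_pathHom hP
  map_lact := pathV_lact hP
  map_ract := pathV_ract hP
  isometric := star_pathV_mul_pathV hP

/-- The empty path has head `1` and tail empty, so its matrix coefficients only move `Y⋆` onto `h`.
-/
theorem star_pathV_pathVec_nil (Y : arveson P) (h : H) :
    star (pathV hP Y) (pathVec hP [] h) = pathVec hP [] (star (Y : H →L[ℂ] H) h) := by
  refine path_ext_inner hP fun T g => ?_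
  rw [ContinuousLinearMap.star_eq_adjoint, ContinuousLinearMap.adjoint_inner_right,
    ← inner_conj_symm, inner_pathVec_pathV, ← inner_conj_symm (pathVec hP T g), inner_pathVec]
  rfl

theorem adjoint_pathVec_nil (h : H) :
    ContinuousLinearMap.adjoint (pathVec hP []) (pathVec hP [] h) = h := by
  refine ext_inner_left ℂ fun g => ?_
  rw [ContinuousLinearMap.adjoint_inner_right, inner_pathVec, pathKernel]
  rfl

/-- The minimal isometric dilation of the identity representation on the path space. -/
def pathDilation (hn : IsNormal M (fun A : M => (P A : H →L[ℂ] H))) :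
    MinimalIsometricDilation P (identityT P) (identityσ M) (PathSpace hP) where
  toIsometricRep := pathIsometricRep hP
  W := pathVec hP []
  isometry_W := (ContinuousLinearMap.norm_map_iff_adjoint_comp_self _).2 (by
    ext h
    exact adjoint_pathVec_nil hP h)
  commute_proj S := by
    have h1 : ∀ S : M.commutant, pathHom hP S ∘L pathVec hP []
        = pathVec hP [] ∘L (S : H →L[ℂ] H) := fun S => by
      ext h
      exact pathHom_pathVec hP S [] h
    have h2 := congrArg ContinuousLinearMap.adjoint (h1 (star S))
    rw [ContinuousLinearMap.adjoint_comp, ContinuousLinearMap.adjoint_comp, map_star,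
      ContinuousLinearMap.star_eq_adjoint, ContinuousLinearMap.adjoint_adjoint] at h2
    change (_ ∘L _) ∘L pathHom hP S = pathHom hP S ∘L (_ ∘L _)
    rw [ContinuousLinearMap.comp_assoc, h2, ← ContinuousLinearMap.comp_assoc (pathHom hP S), h1,
      ContinuousLinearMap.comp_assoc]
    congr 2
    exact star_star (S : H →L[ℂ] H)
  restrict S := by
    ext h
    exact pathHom_pathVec hP S [] h
  invariant Y h := ⟨_, (star_pathV_pathVec_nil hP Y h).symm⟩
  compress Y := by
    ext h
    refine ext_inner_left ℂ fun g => ?_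
    change inner ℂ g (ContinuousLinearMap.adjoint (pathVec hP []) (pathV hP Y (pathVec hP [] h)))
      = inner ℂ g ((Y : H →L[ℂ] H) h)
    rw [ContinuousLinearMap.adjoint_inner_right, ← ContinuousLinearMap.adjoint_inner_left,
      ← ContinuousLinearMap.star_eq_adjoint, star_pathV_pathVec_nil, inner_pathVec, pathKernel,
      ContinuousLinearMap.star_eq_adjoint, ContinuousLinearMap.adjoint_inner_left]
    rfl
  minimal L hL hW hred := by
    refine Submodule.eq_top_iff'.2 (mem_of_pathVec_mem hP hL fun T => ?_)
    induction T with
    | nil => exact hW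
    | cons S T ih =>
      intro h
      rw [← pathInsert_tmul]
      -- `L` contains the images `V(Y)(T ⊗ x)`, which are the insertions of `Φ_Y⋆x` into `T`; by
      -- totality it contains the insertion of all of `M ⊗_P H`, in particular of `S ⊗ h`.
      refine mem_of_adjoint_phi_mem hn (L := L.comap (pathInsert hP T).toLinearMap)
        (hL.preimage (pathInsert hP T).continuous) (fun Y x => ?_) _
      have := hred.1 Y _ (ih x)
      change pathV hP Y _ ∈ L at this
      rwa [pathV_pathVec] at this

end PathSpace

end

end ArvesonDilation

/-! ### The theorem -/

theorem theorem1p17 {H : Type u} [NormedAddCommGroup H] [InnerProductSpace ℂ H] [CompleteSpace H]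
    (M : VonNeumannAlgebra H) (P : M →CP M) (hP_unital : P 1 = 1)
    (hP_normal : IsNormal M (fun A : M => (P A : H →L[ℂ] H))) :
    -- the identity representation of `E_P` has a minimal isometric dilation `(V, ρ)`
    (∃ (K : Type u) (_ : NormedAddCommGroup K) (_ : InnerProductSpace ℂ K) (_ : CompleteSpace K),
      Nonempty (MinimalIsometricDilation P (identityT P) (identityσ M) K)) ∧
    -- and for every such dilation, with embedding `W` and `R = ρ(M')'`:
    ∀ (K : Type v) [NormedAddCommGroup K] [InnerProductSpace ℂ K] [CompleteSpace K]
      (D : MinimalIsometricDilation P (identityT P) (identityσ M) K),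
      -- `W⋆RW = M`
      ((fun S : K →L[ℂ] K => ContinuousLinearMap.adjoint D.W ∘L S ∘L D.W) ''
          (D.algebra : Set (K →L[ℂ] K)) = (M : Set (H →L[ℂ] H))) ∧
      -- `M` is a corner of `R`: the projection `e = WW⋆` is in `R` and `WMW⋆ = eRe`
      (D.W ∘L ContinuousLinearMap.adjoint D.W ∈ D.algebra) ∧
      ((fun A : H →L[ℂ] H => D.W ∘L A ∘L ContinuousLinearMap.adjoint D.W) ''
          (M : Set (H →L[ℂ] H)) =
        (fun S : K →L[ℂ] K => (D.W ∘L ContinuousLinearMap.adjoint D.W) * S *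
          (D.W ∘L ContinuousLinearMap.adjoint D.W)) '' (D.algebra : Set (K →L[ℂ] K))) ∧
      -- `R'` is the image of `M'` under the normal homomorphism `ρ`
      ((D.algebra.commutant : Set (K →L[ℂ] K)) = Set.range D.ρ) ∧
      -- `Θ_V` is a unital normal `*`-endomorphism of `R`
      (∃ θ : D.algebra →⋆ₐ[ℂ] D.algebra, (∀ S, θ S = D.induced S) ∧
        IsNormal D.algebra (fun S : D.algebra => (θ S : K →L[ℂ] K))) ∧
      -- `Pⁿ(T) = W⋆ Θ_Vⁿ(WTW⋆) W` and `Pⁿ(W⋆SW) = W⋆ Θ_Vⁿ(S) W`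
      ∀ n : ℕ,
        (∀ T : M, ∃ hT : D.W ∘L (T : H →L[ℂ] H) ∘L ContinuousLinearMap.adjoint D.W ∈ D.algebra,
          ((⇑P)^[n] T : H →L[ℂ] H) = ContinuousLinearMap.adjoint D.W ∘L
            (D.induced^[n] ⟨_, hT⟩ : K →L[ℂ] K) ∘L D.W) ∧
        (∀ S : D.algebra,
          ∃ hS : ContinuousLinearMap.adjoint D.W ∘L (S : K →L[ℂ] K) ∘L D.W ∈ M,
          ((⇑P)^[n] ⟨_, hS⟩ : H →L[ℂ] H) = ContinuousLinearMap.adjoint D.W ∘L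
            (D.induced^[n] S : K →L[ℂ] K) ∘L D.W) := by
  refine ⟨⟨PathSpace hP_unital, inferInstance, inferInstance, inferInstance,
    ⟨pathDilation hP_unital hP_normal⟩⟩, fun K _ _ _ D => ⟨D.compress_image, D.proj_mem, D.corner_eq,
    D.commutant_eq_range, D.exists_endomorphism hP_unital hP_normal, fun n => ⟨fun T =>
      ⟨D.dilate_mem T.2, ?_⟩, fun S => ⟨D.compress_mem S.2, D.iterate_compress hP_normal n S⟩⟩⟩⟩
  -- The formula for `T` is the one for `S = WTW⋆`, since `W⋆(WTW⋆)W = T`.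
  rw [← D.iterate_compress hP_normal n ⟨_, D.dilate_mem T.2⟩]
  congr 2
  exact Subtype.ext (D.compress_dilate T).symm
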